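/- Let $p$ be an odd prime, let $X=\{0,\dots,p-1\}$ (identified with $\mathbb F_p$), and let $X^*$ be the $p$-regular rooted tree whose vertices are the finite words over $X$, a word $u$ being joined to the words $ux$ with $x\in X$. For $g\in\operatorname{Aut}(X^*)$ and a vertex $u$, the section $g|_u\in\operatorname{Aut}(X^*)$ is defined by $(uv)^g=u^g\,v^{g|_u}$ for all words $v$, and $g|^{\varnothing}\in\operatorname{Sym}(X)$ denotes the action of $g$ on the first level $X$. Let $\mathbf e=(\mathbf e_1,\dots,\mathbf e_{p-1})\in\mathbb F_p^{p-1}$ be non-constant, i.e. with at least two different entries. The GGS-group $G=G_{\mathbf e}$ is the subgroup of $\operatorname{Aut}(X^*)$ generated by the automorphism $a$ given by $(xv)^a=(x+1)v$ for $x\in X$ and words $v$, and the automorphism $b$ that fixes the first level and has the sections $b|_0=b$ and $b|_x=a^{\mathbf e_x}$ for $x=1,\dots,p-1$. Let $P(G)=\{(g|_u)|^{\varnothing} : g\in G,\ u\in X^*\}\le\operatorname{Sym}(X)$ be the local permutation group of $G$. Let $F_\infty$ be the free group on countably many generators, and let $R\subseteq F_\infty$ be the set of all group laws of $P(G)$,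 i.e. of all elements that become trivial under every assignment of the generators to elements of $P(G)$. Put $R_1=R$, and for $n>1$ let $R_n$ be the set of all elements $s(r_1,\dots,r_k)$ (with $k \geq 0$ arbitrary) obtained from an element $s\in R_{n-1}$, in which exactly $k$ generators occur, by replacing these generators by elements $r_1,\dots,r_k\in R$, no two of which have a generator in common. For $n\ge 1$, let $\mathrm L_n(G)$ be the subgroup of $G$ generated by the images of all elements of $R_n$ under all assignments of the generators of $F_\infty$ to elements of $G$; by convention, $R_0$ is the set of free generators of $F_\infty$ and, accordingly, $\mathrm L_0(G)=G$. Then the series $(\mathrm L_n(G))_{n}$ of iterated local laws coincides with the derived series of $G$: for all integers $n\ge 0$, $$\mathrm L_n(G)=G^{(n)},$$ where $G^{(0)}=G$ and $G^{(n+1)}=[G^{(n)},G^{(n)}]$. -/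

import Mathlib

/-- The rooted tree `X^*`: the Cayley graph of the free monoid on `X`. Vertices are the finite words
over `X`, and a word `u` is joined to each of the words `u x` with `x` a letter. -/
def wordTree (X : Type) : SimpleGraph (List X) where
  Adj u v := (∃ x, v = u ++ [x]) ∨ (∃ x, u = v ++ [x])
  symm := ⟨fun _ _ h => h.symm⟩
  loopless := ⟨fun u h => by
    rcases h with ⟨x, hx⟩ | ⟨x, hx⟩ <;> simpa using congrArg List.length hx⟩

/-- The group `Aut(X^*)` of all graph automorphisms of the tree `X^*`. -/
abbrev TreeAut (X : Type) : Type := wordTree X ≃g wordTree X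

/-- `h` is the section of `g` at the vertex `u`: the image of `u v` under `g` is the image of `u`
under `g` followed by the image of `v` under `h`, for all words `v`. -/
def IsSectionAt {X : Type} (g : TreeAut X) (u : List X) (h : TreeAut X) : Prop :=
  ∀ v : List X, g (u ++ v) = g u ++ h v

/-- `σ` is the action of `h` at the root, i.e. on the first level `X` of the tree. -/
def IsRootAction {X : Type} (h : TreeAut X) (σ : Equiv.Perm X) : Prop :=
  ∀ x : X, h [x] = [σ x]

/-- The local permutation group `P(G)`, consisting of the root actions of all sections of all
elements of `G`. (For a self-similar group this set is a subgroup; in general we take the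
subgroup that it generates.) -/
def localGroup {X : Type} (G : Subgroup (TreeAut X)) : Subgroup (Equiv.Perm X) :=
  Subgroup.closure
    {σ | ∃ g ∈ G, ∃ (u : List X) (h : TreeAut X), IsSectionAt g u h ∧ IsRootAction h σ}

/-- The set `R(H)` of all group laws of `H`: the elements of the free group on countably many
generators that are trivial under every assignment of the generators to elements of `H`. -/
def groupLaws (H : Type) [Group H] : Set (FreeGroup ℕ) :=
  {w | ∀ φ : ℕ → H, FreeGroup.lift φ w = 1}

/-- The set of (indices of) generators occurring in the reduced word of an element of the free
group. -/
def gensOf (w : FreeGroup ℕ) : Set ℕ :=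
  {i | ∃ b : Bool, (i, b) ∈ w.toWord}

/-- The iterates `R_n` of the set `R` of group laws of `H`. We have `R_1 = R`, and `R_{n+1}` consists
of all words obtained from some `s` in `R_n` by replacing the generators occurring in `s` by
elements of `R`, no two of which have a generator in common. By convention `R_0` consists of the
free generators. -/
def iteratedLaws (H : Type) [Group H] : ℕ → Set (FreeGroup ℕ)
  | 0 => Set.range FreeGroup.of
  | 1 => groupLaws H
  | n + 2 =>
    {w | ∃ s ∈ iteratedLaws H (n + 1), ∃ r : ℕ → FreeGroup ℕ,
      (∀ i ∈ gensOf s, r i ∈ groupLaws H) ∧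
      (gensOf s).PairwiseDisjoint (fun i => gensOf (r i)) ∧
      w = FreeGroup.lift r s}

/-- The subgroup of `K` generated by the images of the elements of `R` under all assignments of the
generators of the free group to elements of `K`. -/
def verbalSubgroup (R : Set (FreeGroup ℕ)) (K : Type) [Group K] : Subgroup K :=
  Subgroup.closure {g | ∃ w ∈ R, ∃ φ : ℕ → K, g = FreeGroup.lift φ w}

/-- The series `L_n(G)` of iterated local laws of a group `G` of tree automorphisms. -/
def iteratedLocalLaws {X : Type} (G : Subgroup (TreeAut X)) (n : ℕ) : Subgroup G :=
  verbalSubgroup (iteratedLaws (localGroup G) n) G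

theorem wordTree_adj_cons {X : Type} (x y : X) (u v : List X) :
    (wordTree X).Adj (x :: u) (y :: v) ↔ x = y ∧ (wordTree X).Adj u v := by
  simp only [wordTree, List.cons_append, List.cons.injEq, exists_and_left]
  constructor
  · rintro (⟨h, h'⟩ | ⟨h, h'⟩)
    · exact ⟨h.symm, Or.inl h'⟩
    · exact ⟨h, Or.inr h'⟩
  · rintro ⟨h, h' | h'⟩
    · exact Or.inl ⟨h.symm, h'⟩
    · exact Or.inr ⟨h, h'⟩

theorem wordTree_adj_nil_cons {X : Type} (y : X) (v : List X) :
    (wordTree X).Adj [] (y :: v) ↔ v = [] := by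
  simp [wordTree]

theorem wordTree_adj_cons_nil {X : Type} (y : X) (v : List X) :
    (wordTree X).Adj (y :: v) [] ↔ v = [] := by
  rw [SimpleGraph.adj_comm, wordTree_adj_nil_cons]

theorem wordTree_adj_nil_nil {X : Type} : ¬ (wordTree X).Adj [] [] :=
  SimpleGraph.irrefl _

/-- The rooted automorphism belonging to a permutation `σ` of `X`: it acts on the first letter of a
word by `σ` and fixes all other letters. -/
def rootedAut {X : Type} (σ : Equiv.Perm X) : TreeAut X where
  toFun := fun w => match w with
    | [] => []
    | x :: v => σ x :: v
  invFun := fun w => match w with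
    | [] => []
    | x :: v => σ.symm x :: v
  left_inv := by rintro (_ | ⟨x, v⟩) <;> simp
  right_inv := by rintro (_ | ⟨x, v⟩) <;> simp
  map_rel_iff' := by
    rintro (_ | ⟨x, u⟩) (_ | ⟨y, v⟩) <;>
      simp [wordTree_adj_cons, wordTree_adj_nil_cons, wordTree_adj_cons_nil]

/-- The rooted generator `a = (0 1 ... p-1)` of a GGS-group. -/
def rootedGen (p : ℕ) : TreeAut (ZMod p) :=
  rootedAut (Equiv.addRight (1 : ZMod p))

/-- The underlying map of the directed generator: it fixes the root and the first level, its section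
at `0` is the map itself, and its section at every letter `x ≠ 0` is `c x`. -/
def directedFun {p : ℕ} (c : {x : ZMod p // x ≠ 0} → TreeAut (ZMod p)) :
    List (ZMod p) → List (ZMod p)
  | [] => []
  | x :: v => if h : x = 0 then 0 :: directedFun c v else x :: c ⟨x, h⟩ v

theorem directedFun_inv {p : ℕ} (c d : {x : ZMod p // x ≠ 0} → TreeAut (ZMod p))
    (hcd : ∀ x v, d x (c x v) = v) (w : List (ZMod p)) :
    directedFun d (directedFun c w) = w := by
  induction w with
  | nil => rfl
  | cons x v ih =>
    by_cases h : x = 0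
    · simp [directedFun, h, ih]
    · simp [directedFun, h, hcd]

theorem directedFun_eq_nil {p : ℕ} (c : {x : ZMod p // x ≠ 0} → TreeAut (ZMod p))
    (w : List (ZMod p)) : directedFun c w = [] ↔ w = [] := by
  cases w with
  | nil => simp [directedFun]
  | cons x v => by_cases h : x = 0 <;> simp [directedFun, h]

theorem directedFun_adj {p : ℕ} (c : {x : ZMod p // x ≠ 0} → TreeAut (ZMod p))
    (hc : ∀ x, c x [] = []) (u v : List (ZMod p)) :
    (wordTree (ZMod p)).Adj (directedFun c u) (directedFun c v) ↔
      (wordTree (ZMod p)).Adj u v := by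
  have hc' : ∀ x w, c x w = [] ↔ w = [] := fun x w => by
    constructor
    · intro h
      exact (c x).injective (h.trans (hc x).symm)
    · rintro rfl
      exact hc x
  induction u generalizing v with
  | nil =>
    cases v with
    | nil => rfl
    | cons y v =>
      by_cases h : y = 0
      · simp [directedFun, h, wordTree_adj_nil_cons, directedFun_eq_nil]
      · simp [directedFun, h, wordTree_adj_nil_cons, hc']
  | cons x u ih =>
    cases v with
    | nil =>
      by_cases h : x = 0
      · simp [directedFun, h, wordTree_adj_cons_nil, directedFun_eq_nil]
      · simp [directedFun, h, wordTree_adj_cons_nil, hc']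
    | cons y v =>
      by_cases h : x = 0
      · by_cases h' : y = 0
        · simp [directedFun, h, h', wordTree_adj_cons, ih]
        · simp [directedFun, h, h', wordTree_adj_cons, Ne.symm h']
      · by_cases h' : y = 0
        · simp [directedFun, h, h', wordTree_adj_cons]
        · by_cases hxy : x = y
          · subst hxy
            simp only [directedFun, h, dite_false, wordTree_adj_cons, true_and]
            exact (c ⟨x, h⟩).map_rel_iff'
          · simp [directedFun, h, h', wordTree_adj_cons, hxy]

theorem rootedGen_pow_nil (p k : ℕ) : (rootedGen p ^ k) [] = [] := by
  induction k with
  | zero => rfl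
  | succ k ih => rw [pow_succ', RelIso.mul_apply, ih]; rfl

/-- The directed generator `b` of the GGS-group with defining tuple `e`: it stabilises the first
level, its section at `0` is `b` and its section at `x ≠ 0` is `a ^ (e x)`. The entries of
`e` are indexed by `1, ..., p-1`, that is, by the non-zero elements of `ZMod p`. -/
def directedGen {p : ℕ} (e : {x : ZMod p // x ≠ 0} → ZMod p) : TreeAut (ZMod p) where
  toFun := directedFun (fun x => rootedGen p ^ (e x).val)
  invFun := directedFun (fun x => (rootedGen p ^ (e x).val)⁻¹)
  left_inv := directedFun_inv _ _ (fun _ _ => RelIso.inv_apply_self _ _)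
  right_inv := directedFun_inv _ _ (fun _ _ => RelIso.apply_inv_self _ _)
  map_rel_iff' := directedFun_adj _ (fun _ => rootedGen_pow_nil p _) _ _

/-- The GGS-group defined by the tuple `e`, generated by `a` and `b`. -/
def GGSGroup {p : ℕ} (e : {x : ZMod p // x ≠ 0} → ZMod p) : Subgroup (TreeAut (ZMod p)) :=
  Subgroup.closure {rootedGen p, directedGen e}

open scoped commutatorElement

set_option linter.unusedSectionVars false

/-! ### Relative normality and commutators -/

/-! Every element of G permutes the children of each vertex by a translation, so P(G) is cyclic of
order p. Its laws hold in all elementary abelian p-groups, while products of commutators in separate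
variables are among them. Hence the laws of P(G) cut out the commutator subgroup in any group K
whose elements have p-th powers in K', and `verbalSubgroup_iteratedLaws` iterates this. What remains
is that every factor G^(n)/G^(n+1) has exponent dividing p, which is `GGSData.pow_mem_der_succ`.

For this, write ψ for the map from p-tuples to automorphisms with these sections. As p is odd and a,
b have order p, the class-2 quotient G/γ₃ has exponent dividing p (`pow_mem_γ₃`). Elements of G' are
ψ of tuples in G, and elements of G^(n+1) are ψ of tuples in G^(n) (`exists_psi_eq_of_mem_der`). So
p-th powers may be taken componentwise, provided that G'' contains the direct power of γ₃
(`γ₃_le_level_der_two`) and G^(n+3) that of G^(n+2) (`der_le_level`).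

The inclusion for γ₃ is the core. It comes from commutators of conjugates of b, which have at most
two non-trivial components; one of these must be removed, and how depends on whether the tuple
satisfies a first-order recurrence, is not symmetric under t ↦ -t, or is symmetric. The arguments
take place inside a larger group on which ψ is defined, so normality is always relative to G. -/

/-- The subgroup `N` is stable under conjugation by the elements of `G`. -/
def NormalizedBy {Γ : Type*} [Group Γ] (N G : Subgroup Γ) : Prop :=
  ∀ g ∈ G, ∀ n ∈ N, g * n * g⁻¹ ∈ N

namespace NormalizedBy

variable {Γ : Type*} [Group Γ] {N H K G : Subgroup Γ}

theorem refl (G : Subgroup Γ) : NormalizedBy G G := fun _ hg _ hn =>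
  G.mul_mem (G.mul_mem hg hn) (G.inv_mem hg)

theorem mono (h : NormalizedBy N G) (hK : K ≤ G) : NormalizedBy N K :=
  fun g hg => h g (hK hg)

theorem conj' (h : NormalizedBy N G) {g n : Γ} (hg : g ∈ G) (hn : n ∈ N) : g⁻¹ * n * g ∈ N := by
  simpa using h g⁻¹ (G.inv_mem hg) n hn

theorem commutator (hH : NormalizedBy H G) (hK : NormalizedBy K G) : NormalizedBy ⁅H, K⁆ G := by
  intro g hg n hn
  have h1 : n ∈ (⁅H, K⁆).comap (MulAut.conj g).toMonoidHom := by
    refine (Subgroup.commutator_le.2 ?_ : ⁅H, K⁆ ≤ _) hn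
    intro x hx y hy
    rw [Subgroup.mem_comap, map_commutatorElement]
    exact Subgroup.commutator_mem_commutator (hH g hg x hx) (hK g hg y hy)
  simpa using h1

theorem commutator_mem (h : NormalizedBy N G) {g n : Γ} (hn : n ∈ N) (hg : g ∈ G) : ⁅n, g⁆ ∈ N := by
  have := N.mul_mem hn (h g hg n⁻¹ (N.inv_mem hn))
  simpa [commutatorElement_def, mul_assoc] using this

theorem commutator_mem' (h : NormalizedBy N G) {g n : Γ} (hn : n ∈ N) (hg : g ∈ G) :
    ⁅g, n⁆ ∈ N := by
  rw [← commutatorElement_inv]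
  exact N.inv_mem (h.commutator_mem hn hg)

theorem commutator_le (h : NormalizedBy N G) : ⁅N, G⁆ ≤ N :=
  Subgroup.commutator_le.2 fun _ hn _ hg => h.commutator_mem hn hg

theorem closure_commutator_le {S T : Set Γ} (hS : NormalizedBy N (Subgroup.closure S))
    (hT : NormalizedBy N (Subgroup.closure T)) (h : ∀ s ∈ S, ∀ t ∈ T, ⁅s, t⁆ ∈ N) :
    ⁅Subgroup.closure S, Subgroup.closure T⁆ ≤ N := by
  rw [Subgroup.commutator_le]
  intro g hg k hk
  have h1 : ∀ t ∈ T, ⁅g, t⁆ ∈ N := by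
    intro t ht
    induction hg using Subgroup.closure_induction with
    | mem x hx => exact h x hx t ht
    | one => simp
    | mul x y hx hy ihx ihy =>
      have : ⁅x * y, t⁆ = x * ⁅y, t⁆ * x⁻¹ * ⁅x, t⁆ := by
        simp only [commutatorElement_def]; group
      rw [this]
      exact N.mul_mem (hS x hx _ ihy) ihx
    | inv x hx ih =>
      have : ⁅x⁻¹, t⁆ = x⁻¹ * ⁅x, t⁆⁻¹ * x := by
        simp only [commutatorElement_def]; group
      rw [this]
      exact hS.conj' hx (N.inv_mem ih)
  induction hk using Subgroup.closure_induction with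
  | mem x hx => exact h1 x hx
  | one => simp
  | mul x y hx hy ihx ihy =>
    have : ⁅g, x * y⁆ = ⁅g, x⁆ * (x * ⁅g, y⁆ * x⁻¹) := by
      simp only [commutatorElement_def]; group
    rw [this]
    exact N.mul_mem ihx (hT x hx _ ihy)
  | inv x hx ih =>
    have : ⁅g, x⁻¹⁆ = x⁻¹ * ⁅g, x⁆⁻¹ * x := by
      simp only [commutatorElement_def]; group
    rw [this]
    exact hT.conj' hx (N.inv_mem ih)

/-- The quotient of `G` by a subgroup `N` that it normalizes, as a homomorphism out of `G`. -/
theorem exists_quotient {Γ : Type} [Group Γ] {N G : Subgroup Γ} (h : NormalizedBy N G) :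
    ∃ (Q : Type) (_ : Group Q) (π : G →* Q), Function.Surjective π ∧
      ∀ g : G, π g = 1 ↔ (g : Γ) ∈ N := by
  have : (N.subgroupOf G).Normal := ⟨fun n hn g => by
    rw [Subgroup.mem_subgroupOf] at hn ⊢
    exact h g g.2 n hn⟩
  refine ⟨G ⧸ N.subgroupOf G, inferInstance, QuotientGroup.mk' _, QuotientGroup.mk'_surjective _,
    fun g => ?_⟩
  rw [QuotientGroup.mk'_apply, QuotientGroup.eq_one_iff, Subgroup.mem_subgroupOf]

end NormalizedBy

theorem commutatorElement_pow_right_of_commute {Q : Type*} [Group Q] {y z : Q}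
    (h : Commute ⁅y, z⁆ z) (n : ℕ) : ⁅y, z ^ n⁆ = ⁅y, z⁆ ^ n := by
  induction n with
  | zero => simp
  | succ n ih =>
    have h1 : ⁅y, z ^ (n + 1)⁆ = ⁅y, z ^ n⁆ * (z ^ n * ⁅y, z⁆ * (z ^ n)⁻¹) := by
      simp only [commutatorElement_def, pow_succ]; group
    rw [h1, ih, ← (h.pow_right n).eq, mul_inv_cancel_right, pow_succ]

/-- The Hall formula in class 2: moving y past x costs one central commutator, and `n.choose 2` such
moves are needed. -/
theorem mul_pow_of_commute_commutator {Q : Type*} [Group Q] {x y : Q}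
    (hx : Commute ⁅y, x⁆ x) (hy : Commute ⁅y, x⁆ y) (n : ℕ) :
    (x * y) ^ n = x ^ n * y ^ n * ⁅y, x⁆ ^ (n.choose 2) := by
  have key : ∀ n : ℕ, y ^ n * x = x * y ^ n * ⁅y, x⁆ ^ n := by
    intro n
    induction n with
    | zero => simp
    | succ n ih =>
      have h1 : y * x = x * y * ⁅y, x⁆ := by
        rw [mul_assoc, ← hy.eq, ← mul_assoc, ← hx.eq, commutatorElement_def]; group
      calc y ^ (n + 1) * x = y * (y ^ n * x) := by rw [pow_succ', mul_assoc]
        _ = (y * x) * y ^ n * ⁅y, x⁆ ^ n := by rw [ih]; group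
        _ = x * y * (⁅y, x⁆ * y ^ n) * ⁅y, x⁆ ^ n := by rw [h1]; group
        _ = x * y ^ (n + 1) * ⁅y, x⁆ ^ (n + 1) := by
          rw [(hy.pow_right n).eq, pow_succ' y, pow_succ' ⁅y, x⁆]; simp only [mul_assoc]
  induction n with
  | zero => simp
  | succ n ih =>
    have hc : (n + 1).choose 2 = n + n.choose 2 := by
      rw [Nat.choose_succ_succ' n 1, Nat.choose_one_right]
    have c1 := (hx.mul_right hy).pow_left (n.choose 2)
    calc (x * y) ^ (n + 1) = x ^ n * y ^ n * (⁅y, x⁆ ^ n.choose 2 * (x * y)) := by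
          rw [pow_succ, ih, mul_assoc (x ^ n * y ^ n)]
      _ = x ^ n * (y ^ n * x) * (y * ⁅y, x⁆ ^ n.choose 2) := by rw [c1.eq]; group
      _ = x ^ n * (x * y ^ n) * ((⁅y, x⁆ ^ n * y) * ⁅y, x⁆ ^ n.choose 2) := by
          rw [key]; group
      _ = x ^ (n + 1) * y ^ (n + 1) * ⁅y, x⁆ ^ ((n + 1).choose 2) := by
          rw [(hy.pow_left n).eq, hc, pow_add ⁅y, x⁆, pow_succ x, pow_succ y]; group

/-! ### Exponents in `ZMod p` -/

section ZModPow

variable {p : ℕ} [Fact p.Prime] {Γ : Type*} [Group Γ]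

/-- The power of `g` with exponent in `ZMod p`; it behaves well when `g ^ p = 1`. -/
def zmodPow (g : Γ) (x : ZMod p) : Γ := g ^ x.val

theorem zmodPow_zero (g : Γ) : zmodPow g (0 : ZMod p) = 1 := by simp [zmodPow]

theorem zmodPow_one (g : Γ) : zmodPow g (1 : ZMod p) = g := by
  have : Fact (1 < p) := ⟨(Fact.out : p.Prime).one_lt⟩
  simp [zmodPow, ZMod.val_one]

theorem zmodPow_natCast {g : Γ} (hg : g ^ p = 1) (n : ℕ) : zmodPow g (n : ZMod p) = g ^ n := by
  rw [zmodPow, ZMod.val_natCast, ← pow_mod_orderOf, Nat.mod_mod_of_dvd _ (orderOf_dvd_of_pow_eq_one hg),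
    pow_mod_orderOf]

theorem zmodPow_add {g : Γ} (hg : g ^ p = 1) (x y : ZMod p) :
    zmodPow g (x + y) = zmodPow g x * zmodPow g y := by
  rw [← ZMod.natCast_zmod_val x, ← ZMod.natCast_zmod_val y, ← Nat.cast_add, zmodPow_natCast hg,
    zmodPow_natCast hg, zmodPow_natCast hg, pow_add]

theorem zmodPow_neg {g : Γ} (hg : g ^ p = 1) (x : ZMod p) :
    zmodPow g (-x) = (zmodPow g x)⁻¹ := by
  rw [eq_inv_iff_mul_eq_one, ← zmodPow_add hg, neg_add_cancel, zmodPow_zero]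

theorem zmodPow_sub {g : Γ} (hg : g ^ p = 1) (x y : ZMod p) :
    zmodPow g (x - y) = zmodPow g x * (zmodPow g y)⁻¹ := by
  rw [sub_eq_add_neg, zmodPow_add hg, zmodPow_neg hg]

theorem zmodPow_zmodPow {g : Γ} (hg : g ^ p = 1) (x y : ZMod p) :
    zmodPow (zmodPow g x) y = zmodPow g (x * y) := by
  conv_rhs => rw [← ZMod.natCast_zmod_val x, ← ZMod.natCast_zmod_val y, ← Nat.cast_mul,
    zmodPow_natCast hg, pow_mul]
  rfl

theorem zmodPow_mem {H : Subgroup Γ} {g : Γ} (hg : g ∈ H) (x : ZMod p) : zmodPow g x ∈ H :=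
  H.pow_mem hg _

theorem mem_of_zmodPow_mem {H : Subgroup Γ} {g : Γ} (hg : g ^ p = 1) {x : ZMod p} (hx : x ≠ 0)
    (h : zmodPow g x ∈ H) : g ∈ H := by
  have := zmodPow_mem h x⁻¹
  rwa [zmodPow_zmodPow hg, mul_inv_cancel₀ hx, zmodPow_one] at this

theorem zmodPow_pow_prime {g : Γ} (hg : g ^ p = 1) (x : ZMod p) : (zmodPow g x) ^ p = 1 := by
  rw [zmodPow, ← pow_mul, mul_comm, pow_mul, hg, one_pow]

end ZModPow

/-! ### Iterated laws of groups of prime exponent -/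

theorem map_subtype_derivedSeries_commutator (K : Type*) [Group K] (n : ℕ) :
    (derivedSeries (commutator K) n).map (commutator K).subtype = derivedSeries K (n + 1) := by
  induction n with
  | zero =>
    rw [derivedSeries_zero, ← MonoidHom.range_eq_map, Subgroup.range_subtype]
    rfl
  | succ n ih => rw [derivedSeries_succ, Subgroup.map_commutator, ih, derivedSeries_succ _ (n + 1)]

theorem gensOf_map_subset (f : ℕ → ℕ) (w : FreeGroup ℕ) :
    gensOf (FreeGroup.map f w) ⊆ Set.range f := by
  rintro i ⟨b, hb⟩
  have h1 : FreeGroup.map f w = FreeGroup.mk (w.toWord.map fun x => (f x.1, x.2)) := by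
    conv_lhs => rw [← FreeGroup.mk_toWord (x := w), FreeGroup.map.mk]
  rw [h1, FreeGroup.toWord_mk] at hb
  have h2 := (FreeGroup.Red.sublist FreeGroup.reduce.red).subset hb
  obtain ⟨x, -, hx⟩ := List.mem_map.1 h2
  exact ⟨x.1, congrArg Prod.fst hx⟩

theorem lift_congr_gensOf {K : Type*} [Group K] {φ ψ : ℕ → K} {w : FreeGroup ℕ}
    (h : ∀ i ∈ gensOf w, φ i = ψ i) : FreeGroup.lift φ w = FreeGroup.lift ψ w := by
  conv_lhs => rw [← FreeGroup.mk_toWord (x := w), FreeGroup.lift_mk]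
  conv_rhs => rw [← FreeGroup.mk_toWord (x := w), FreeGroup.lift_mk]
  congr 1
  refine List.map_congr_left fun x hx => ?_
  rw [h x.1 ⟨x.2, hx⟩]

theorem lift_lift {K : Type*} [Group K] (φ : ℕ → K) (r : ℕ → FreeGroup ℕ) (w : FreeGroup ℕ) :
    FreeGroup.lift φ (FreeGroup.lift r w) = FreeGroup.lift (fun i => FreeGroup.lift φ (r i)) w := by
  have : (FreeGroup.lift φ).comp (FreeGroup.lift r) =
      FreeGroup.lift (fun i => FreeGroup.lift φ (r i)) := by
    ext i; simp
  exact DFunLike.congr_fun this w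

theorem lift_map {K : Type*} [Group K] (φ : ℕ → K) (f : ℕ → ℕ) (w : FreeGroup ℕ) :
    FreeGroup.lift φ (FreeGroup.map f w) = FreeGroup.lift (φ ∘ f) w := by
  have : (FreeGroup.lift φ).comp (FreeGroup.map f) = FreeGroup.lift (φ ∘ f) := by
    ext i; simp
  exact DFunLike.congr_fun this w

theorem hom_lift {K L : Type*} [Group K] [Group L] (f : K →* L) (φ : ℕ → K) (w : FreeGroup ℕ) :
    f (FreeGroup.lift φ w) = FreeGroup.lift (fun i => f (φ i)) w := by
  have : f.comp (FreeGroup.lift φ) = FreeGroup.lift (fun i => f (φ i)) := by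
    ext i; simp
  exact DFunLike.congr_fun this w

theorem map_mem_groupLaws {P : Type} [Group P] {w : FreeGroup ℕ} (hw : w ∈ groupLaws P)
    (f : ℕ → ℕ) : FreeGroup.map f w ∈ groupLaws P := fun φ => by
  rw [lift_map]; exact hw _

section

variable {p : ℕ} [Fact p.Prime] {P : Type} [Group P]

/-- A law of a group with an element of order `p` holds in all elementary abelian `p`-groups. -/
theorem lift_eq_one_of_mem_groupLaws {σ : P} (hσ : orderOf σ = p) {A : Type*} [CommGroup A]
    (hA : ∀ x : A, x ^ p = 1) {w : FreeGroup ℕ} (hw : w ∈ groupLaws P) (φ : ℕ → A) :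
    FreeGroup.lift φ w = 1 := by
  -- Linear functionals separate the points of an `F_p`-space, and each one followed by x ↦ σ ^ x is
  -- a homomorphism to `P`, where the law holds.
  obtain ⟨inst⟩ : Nonempty (Module (ZMod p) (Additive A)) :=
    ⟨AddCommGroup.zmodModule fun x => hA x.toMul⟩
  have hσ' : σ ^ p = 1 := hσ ▸ pow_orderOf_eq_one σ
  suffices h : Additive.ofMul (FreeGroup.lift φ w) = 0 from h
  refine (Module.forall_dual_apply_eq_zero_iff (ZMod p)
    (Additive.ofMul (FreeGroup.lift φ w))).1 fun f => ?_
  let F : A →* P := MonoidHom.mk' (fun x => zmodPow σ (f (Additive.ofMul x)))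
    fun x y => by rw [ofMul_mul, map_add, zmodPow_add hσ']
  have h1 : F (FreeGroup.lift φ w) = 1 := by rw [hom_lift]; exact hw _
  have h2 : σ ^ (f (Additive.ofMul (FreeGroup.lift φ w))).val = 1 := h1
  rw [← orderOf_dvd_iff_pow_eq_one, hσ] at h2
  rw [← ZMod.natCast_zmod_val (f (Additive.ofMul (FreeGroup.lift φ w)))]
  exact (ZMod.natCast_eq_zero_iff _ _).2 h2

theorem lift_mem_commutator_of_mem_groupLaws {σ : P} (hσ : orderOf σ = p) {K : Type*} [Group K]
    (hK : ∀ x : K, x ^ p ∈ commutator K) {w : FreeGroup ℕ} (hw : w ∈ groupLaws P) (φ : ℕ → K) :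
    FreeGroup.lift φ w ∈ commutator K := by
  rw [← Abelianization.ker_of, MonoidHom.mem_ker, hom_lift]
  refine lift_eq_one_of_mem_groupLaws hσ (fun x => ?_) hw _
  induction x using QuotientGroup.induction_on with
  | H z =>
    have := hK z
    rw [← Abelianization.ker_of, MonoidHom.mem_ker, map_pow] at this
    exact this

/-- A single law suffices for each element of K', not merely a product of law values: this is what
allows the element to be substituted for one variable of another law. -/
theorem exists_law_of_mem_commutator (hP : ∀ x y : P, x * y = y * x) {K : Type*} [Group K] {g : K}
    (hg : g ∈ commutator K) : ∃ r ∈ groupLaws P, ∃ φ : ℕ → K, g = FreeGroup.lift φ r := by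
  rw [commutator_eq_closure] at hg
  induction hg using Subgroup.closure_induction with
  | mem x hx =>
    obtain ⟨y, z, rfl⟩ := hx
    refine ⟨⁅FreeGroup.of 0, FreeGroup.of 1⁆, fun φ => ?_, fun i => if i = 0 then y else z, ?_⟩
    · rw [map_commutatorElement, commutatorElement_eq_one_iff_mul_comm, hP]
    · simp [map_commutatorElement]
  | one => exact ⟨1, fun φ => map_one _, fun _ => 1, by simp⟩
  | mul x y _ _ ihx ihy =>
    obtain ⟨r, hr, φ, rfl⟩ := ihx
    obtain ⟨s, hs, ψ, rfl⟩ := ihy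
    -- Even and odd variables keep the two factors independent, so both assignments can be made at
    -- once.
    refine ⟨FreeGroup.map (fun i => 2 * i) r * FreeGroup.map (fun i => 2 * i + 1) s, fun χ => ?_,
      fun i => if i % 2 = 0 then φ (i / 2) else ψ (i / 2), ?_⟩
    · rw [map_mul, map_mem_groupLaws hr, map_mem_groupLaws hs, mul_one]
    · rw [map_mul, lift_map, lift_map]
      congr 2
      · congr 1; funext i; simp
      · congr 1; funext i
        have h1 : (2 * i + 1) % 2 = 1 := by omega
        have h2 : (2 * i + 1) / 2 = i := by omega
        simp [h1, h2]
  | inv x _ ih =>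
    obtain ⟨r, hr, φ, rfl⟩ := ih
    exact ⟨r⁻¹, fun χ => by rw [map_inv, hr, inv_one], φ, by rw [map_inv]⟩

/-- For a group of exponent `p` modulo its commutator subgroup, and so on along the derived series,
the verbal subgroups of the iterated laws of an abelian group of exponent `p` are the terms of
the derived series. -/
theorem verbalSubgroup_iteratedLaws (hP : ∀ x y : P, x * y = y * x) {σ : P} (hσ : orderOf σ = p)
    (n : ℕ) : ∀ (K : Type) [Group K],
      (∀ m, ∀ g ∈ derivedSeries K m, g ^ p ∈ derivedSeries K (m + 1)) →
      verbalSubgroup (iteratedLaws P n) K = derivedSeries K n := by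
  induction n with
  | zero =>
    intro K _ _
    rw [derivedSeries_zero, eq_top_iff]
    intro g _
    exact Subgroup.subset_closure ⟨FreeGroup.of 0, ⟨0, rfl⟩, fun _ => g, by simp⟩
  | succ n ih =>
    intro K _ hK
    have hK0 : ∀ x : K, x ^ p ∈ commutator K := fun x => hK 0 x (Subgroup.mem_top x)
    -- `R_1` is not defined by substitution into `R_0`, so the first step is treated separately.
    rcases n with _ | n
    · apply le_antisymm
      · refine (Subgroup.closure_le _).2 ?_
        rintro _ ⟨w, hw, φ, rfl⟩
        exact lift_mem_commutator_of_mem_groupLaws hσ hK0 hw φ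
      · intro g hg
        obtain ⟨r, hr, φ, rfl⟩ := exists_law_of_mem_commutator hP hg
        exact Subgroup.subset_closure ⟨r, hr, φ, rfl⟩
    -- Values of `R_{n+2}` on K are values of `R_{n+1}` on K', whose derived series is that of K
    -- shifted by one.
    · have ih' := ih (commutator K) fun m g hg => by
        have h1 := hK (m + 1) g (by
          rw [← map_subtype_derivedSeries_commutator]; exact Subgroup.mem_map_of_mem _ hg)
        rw [← map_subtype_derivedSeries_commutator] at h1
        obtain ⟨k, hk, hkg⟩ := h1
        rwa [show g ^ p = k from Subtype.ext hkg.symm]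
      rw [← map_subtype_derivedSeries_commutator, ← ih']
      apply le_antisymm
      · refine (Subgroup.closure_le _).2 ?_
        rintro _ ⟨_, ⟨s, hs, r, hr, -, rfl⟩, φ, rfl⟩
        classical
        -- Only the variables occurring in `s` are known to be replaced by laws; the others get the
        -- dummy value 1.
        let k : ℕ → commutator K := fun i =>
          if h : i ∈ gensOf s then
            ⟨FreeGroup.lift φ (r i), lift_mem_commutator_of_mem_groupLaws hσ hK0 (hr i h) φ⟩
          else 1
        refine ⟨FreeGroup.lift k s, Subgroup.subset_closure ⟨s, hs, k, rfl⟩, ?_⟩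
        rw [hom_lift, lift_lift]
        refine lift_congr_gensOf fun i hi => ?_
        simp [k, hi]
      · rw [Subgroup.map_le_iff_le_comap]
        refine (Subgroup.closure_le _).2 ?_
        rintro _ ⟨s, hs, k, rfl⟩
        choose r hr φ hφ using fun i => exists_law_of_mem_commutator (P := P) hP (k i).2
        -- Renaming the variables of `r i` by `Nat.pair i` makes the laws use disjoint sets of
        -- generators.
        refine Subgroup.subset_closure ⟨_, ⟨s, hs, fun i => FreeGroup.map (Nat.pair i) (r i),
          fun i _ => map_mem_groupLaws (hr i) _, ?_, rfl⟩,
          fun m => φ m.unpair.1 m.unpair.2, ?_⟩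
        · intro i _ j _ hij
          refine Set.disjoint_left.2 fun m hmi hmj => hij ?_
          obtain ⟨x, rfl⟩ := gensOf_map_subset _ _ hmi
          obtain ⟨y, hy⟩ := gensOf_map_subset _ _ hmj
          simpa using congrArg (fun m => (Nat.unpair m).1) hy.symm
        · rw [hom_lift, lift_lift]
          congr 2
          funext i
          rw [lift_map, Subgroup.subtype_apply, hφ i]
          congr 2
          funext m
          simp

end

/-! ### Groups with the recursive presentation of a GGS-group -/

theorem NormalizedBy.of_closure {Γ : Type*} [Group Γ] {S : Set Γ} {N : Subgroup Γ}
    (h : ∀ s ∈ S, ∀ n ∈ N, s * n * s⁻¹ ∈ N) (h' : ∀ s ∈ S, ∀ n ∈ N, s⁻¹ * n * s ∈ N) :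
    NormalizedBy N (Subgroup.closure S) := by
  -- Both conjugations are carried along, since the inverse case of the induction exchanges them.
  suffices H : ∀ g ∈ Subgroup.closure S, ∀ n ∈ N, g * n * g⁻¹ ∈ N ∧ g⁻¹ * n * g ∈ N from
    fun g hg n hn => (H g hg n hn).1
  intro g hg
  induction hg using Subgroup.closure_induction with
  | mem x hx => exact fun n hn => ⟨h x hx n hn, h' x hx n hn⟩
  | one => simp
  | mul x y _ _ ihx ihy =>
    refine fun n hn => ⟨?_, ?_⟩
    · have := (ihx _ (ihy n hn).1).1
      simpa [mul_assoc] using this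
    · have := (ihy _ (ihx n hn).2).2
      simpa [mul_assoc] using this
  | inv x _ ih => exact fun n hn => ⟨by simpa using (ih n hn).2, by simpa using (ih n hn).1⟩

/-- Elements `a` and `b` of a group `Γ` that contains, by means of `psi`, a direct power of itself,
subject to the relations by which the generators of a GGS-group are defined: `a` has order
`p` and shifts the direct factors, and `b` has the components `b` and `a ^ ε x`, `x ≠ 0`. -/
structure GGSData (p : ℕ) [Fact p.Prime] (Γ : Type) [Group Γ] where
  /-- The embedding of the direct power. -/
  psi : (ZMod p → Γ) →* Γ
  /-- The rooted generator. -/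
  a : Γ
  /-- The directed generator. -/
  b : Γ
  /-- The defining tuple. -/
  ε : ZMod p → ZMod p
  odd : Odd p
  a_pow : a ^ p = 1
  b_pow : b ^ p = 1
  conj : ∀ f, a * psi f * a⁻¹ = psi fun x => f (x - 1)
  b_eq : b = psi fun x => if x = 0 then b else zmodPow a (ε x)
  nonconst : ∃ x y, x ≠ 0 ∧ y ≠ 0 ∧ ε x ≠ ε y

/-! ### Components, direct powers and the first-level stabilizer -/

namespace GGSData

variable {p : ℕ} [Fact p.Prime] {Γ : Type} [Group Γ] (S : GGSData p Γ)

/-- The group generated by `a` and `b`. -/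
def grp : Subgroup Γ := Subgroup.closure {S.a, S.b}

/-- The derived series of the group generated by `a` and `b`. -/
def der : ℕ → Subgroup Γ
  | 0 => S.grp
  | n + 1 => ⁅der n, der n⁆

/-- The embedding of the direct factor with index `i`. -/
def single (i : ZMod p) : Γ →* Γ := S.psi.comp (MonoidHom.mulSingle (fun _ => Γ) i)

/-- The largest subgroup whose direct power is contained in `M`. -/
def level (M : Subgroup Γ) : Subgroup Γ := ⨅ i, M.comap (S.single i)

/-- The projection to the component with index `i` of the part of `M` in the direct power. -/
def proj (M : Subgroup Γ) (i : ZMod p) : Subgroup Γ :=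
  (M.comap S.psi).map (Pi.evalMonoidHom (fun _ => Γ) i)

/-- The conjugate of `b` by `a ^ i`. -/
def β (i : ZMod p) : Γ := zmodPow S.a i * S.b * (zmodPow S.a i)⁻¹

/-- The components of the conjugate of `b` by `a ^ i`. -/
def comp (i x : ZMod p) : Γ := if x = i then S.b else zmodPow S.a (S.ε (x - i))

/-- The stabilizer of the first level. -/
def stab : Subgroup Γ := Subgroup.closure (Set.range S.β)

variable {S}

theorem mem_level {M : Subgroup Γ} {g : Γ} : g ∈ S.level M ↔ ∀ i, S.single i g ∈ M := by
  simp [level, Subgroup.mem_iInf]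

theorem mem_proj {M : Subgroup Γ} {i : ZMod p} {g : Γ} :
    g ∈ S.proj M i ↔ ∃ f, S.psi f ∈ M ∧ f i = g := by
  simp [proj]

variable (S)

theorem a_mem : S.a ∈ S.grp := Subgroup.subset_closure (by simp)

theorem b_mem : S.b ∈ S.grp := Subgroup.subset_closure (by simp)

theorem der_succ (n : ℕ) : S.der (n + 1) = ⁅S.der n, S.der n⁆ := rfl

theorem der_normalizedBy (n : ℕ) : NormalizedBy (S.der n) S.grp := by
  induction n with
  | zero => exact NormalizedBy.refl _
  | succ n ih => exact ih.commutator ih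

theorem der_succ_le (n : ℕ) : S.der (n + 1) ≤ S.der n := (NormalizedBy.refl _).commutator_le

theorem der_le_grp (n : ℕ) : S.der n ≤ S.grp := by
  induction n with
  | zero => exact le_rfl
  | succ n ih => exact (S.der_succ_le n).trans ih

theorem conj_zmodPow (c : ZMod p) (f : ZMod p → Γ) :
    zmodPow S.a c * S.psi f * (zmodPow S.a c)⁻¹ = S.psi fun x => f (x - c) := by
  have key : ∀ n : ℕ, S.a ^ n * S.psi f * (S.a ^ n)⁻¹ = S.psi fun x => f (x - n) := by
    intro n
    induction n with
    | zero => simp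
    | succ n ih =>
      have : S.a ^ (n + 1) * S.psi f * (S.a ^ (n + 1))⁻¹ =
          S.a * (S.a ^ n * S.psi f * (S.a ^ n)⁻¹) * S.a⁻¹ := by
        rw [pow_succ']; group
      rw [this, ih, S.conj]
      congr 1
      funext x
      congr 1
      push_cast
      ring
  rw [zmodPow, key, ZMod.natCast_zmod_val]

theorem β_eq (i : ZMod p) : S.β i = S.psi (S.comp i) := by
  rw [β]
  conv_lhs => rw [S.b_eq, S.conj_zmodPow]
  congr 1
  funext x
  simp only [comp, sub_eq_zero]

theorem comp_self (i : ZMod p) : S.comp i i = S.b := by simp [comp]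

variable {S} in
theorem comp_ne {i x : ZMod p} (h : x ≠ i) : S.comp i x = zmodPow S.a (S.ε (x - i)) := by
  simp [comp, h]

theorem zmodPow_psi (f : ZMod p → Γ) (c : ZMod p) :
    zmodPow (S.psi f) c = S.psi fun x => zmodPow (f x) c := by
  rw [zmodPow, ← map_pow]; rfl

theorem single_apply (i : ZMod p) (g : Γ) : S.single i g = S.psi (Pi.mulSingle i g) := rfl

theorem conj_single (i : ZMod p) (g : Γ) (f : ZMod p → Γ) :
    S.psi f * S.single i g * (S.psi f)⁻¹ = S.single i (f i * g * (f i)⁻¹) := by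
  rw [single_apply, single_apply, ← map_inv, ← map_mul, ← map_mul]
  congr 1
  funext x
  by_cases h : x = i
  · subst h; simp
  · simp [h]

theorem commutator_single (i : ZMod p) (g : Γ) (f : ZMod p → Γ) :
    ⁅S.single i g, S.psi f⁆ = S.single i ⁅g, f i⁆ := by
  rw [commutatorElement_def, commutatorElement_def, mul_assoc, mul_assoc, ← mul_assoc (S.psi f),
    ← map_inv, conj_single, ← map_mul]
  simp [mul_assoc]

theorem psi_eq_single_mul_single {i j : ZMod p} (hij : i ≠ j) {f : ZMod p → Γ}
    (hf : ∀ x, x ≠ i → x ≠ j → f x = 1) : S.psi f = S.single i (f i) * S.single j (f j) := by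
  rw [single_apply, single_apply, ← map_mul]
  congr 1
  funext x
  by_cases hi : x = i
  · subst hi; simp [hij]
  · by_cases hj : x = j
    · subst hj; simp [hi]
    · simp [hi, hj, hf x hi hj]

theorem psi_eq_single {i : ZMod p} {f : ZMod p → Γ} (hf : ∀ x, x ≠ i → f x = 1) :
    S.psi f = S.single i (f i) := by
  rw [single_apply]
  congr 1
  funext x
  by_cases hi : x = i
  · subst hi; simp
  · simp [hi, hf x hi]

theorem psi_mem_of_forall_mem_level {M : Subgroup Γ} {f : ZMod p → Γ}
    (hf : ∀ x, f x ∈ S.level M) : S.psi f ∈ M := by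
  have h := Subgroup.pi_mem_of_mulSingle_mem (H := M.comap S.psi) f
    fun i => mem_level.1 (hf i) i
  exact h

theorem conj_zmodPow_single (c i : ZMod p) (g : Γ) :
    zmodPow S.a c * S.single i g * (zmodPow S.a c)⁻¹ = S.single (i + c) g := by
  rw [single_apply, conj_zmodPow, single_apply]
  congr 1
  funext x
  by_cases h : x = i + c
  · subst h; simp
  · have : x - c ≠ i := fun h' => h (by rw [← h']; ring)
    simp [h, this]

variable {S} in
theorem single_mem_shift {M : Subgroup Γ} (hM : NormalizedBy M S.grp) {i : ZMod p} {g : Γ}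
    {j : ZMod p} {h : Γ} (H : S.single i g * S.single j h ∈ M) (c : ZMod p) :
    S.single (i + c) g * S.single (j + c) h ∈ M := by
  rw [← conj_zmodPow_single, ← conj_zmodPow_single]
  have := hM _ (zmodPow_mem S.a_mem c) _ H
  simpa [mul_assoc] using this

variable {S} in
theorem mem_level_of_single_mem {M : Subgroup Γ} (hM : NormalizedBy M S.grp) {i : ZMod p} {g : Γ}
    (h : S.single i g ∈ M) : g ∈ S.level M := by
  rw [mem_level]
  intro j
  have := hM _ (zmodPow_mem S.a_mem (j - i)) _ h
  rwa [conj_zmodPow_single, add_sub_cancel] at this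

theorem β_mem_grp (i : ZMod p) : S.β i ∈ S.grp :=
  NormalizedBy.refl _ _ (zmodPow_mem S.a_mem i) _ S.b_mem

theorem stab_le_grp : S.stab ≤ S.grp := by
  rw [stab, Subgroup.closure_le]
  rintro _ ⟨i, rfl⟩
  exact S.β_mem_grp i

theorem β_mem_stab (i : ZMod p) : S.β i ∈ S.stab := Subgroup.subset_closure ⟨i, rfl⟩

theorem b_mem_stab : S.b ∈ S.stab := by
  simpa [β, zmodPow_zero] using S.β_mem_stab 0

theorem β_mul_inv_mem (j k : ZMod p) : S.β j * (S.β k)⁻¹ ∈ S.der 1 := by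
  have h : ∀ i, S.β i * S.b⁻¹ ∈ S.der 1 := fun i =>
    Subgroup.commutator_mem_commutator (zmodPow_mem S.a_mem i) S.b_mem
  have := (S.der 1).mul_mem (h j) ((S.der 1).inv_mem (h k))
  simpa using this

theorem β_conj (c i : ZMod p) : zmodPow S.a c * S.β i * (zmodPow S.a c)⁻¹ = S.β (i + c) := by
  rw [β, β, add_comm, zmodPow_add S.a_pow]
  group

theorem stab_normalizedBy : NormalizedBy S.stab S.grp := by
  have key : ∀ c : ZMod p, ∀ n ∈ S.stab, zmodPow S.a c * n * (zmodPow S.a c)⁻¹ ∈ S.stab := by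
    intro c n hn
    have : S.stab ≤ S.stab.comap (MulAut.conj (zmodPow S.a c)).toMonoidHom := by
      conv_lhs => rw [stab]
      rw [Subgroup.closure_le]
      rintro _ ⟨i, rfl⟩
      simpa [β_conj] using S.β_mem_stab (i + c)
    simpa using this hn
  refine NormalizedBy.of_closure ?_ ?_
  · rintro s (rfl | rfl) n hn
    · simpa [zmodPow_one] using key 1 n hn
    · exact NormalizedBy.refl _ _ S.b_mem_stab _ hn
  · rintro s (rfl | rfl) n hn
    · simpa [zmodPow_neg S.a_pow, zmodPow_one] using key (-1) n hn
    · exact (NormalizedBy.refl _).conj' S.b_mem_stab hn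

theorem commutator_stab_normalizedBy : NormalizedBy ⁅S.stab, S.stab⁆ S.grp :=
  S.stab_normalizedBy.commutator S.stab_normalizedBy

theorem commutator_stab_le : ⁅S.stab, S.stab⁆ ≤ S.der 1 :=
  Subgroup.commutator_mono S.stab_le_grp S.stab_le_grp

/-- The quotient of two conjugates of b lies in G'. At i its component can be a non-trivial power of
a, because the tuple is not constant, or b times a power of a. -/
theorem grp_le_proj_der_one (i : ZMod p) : S.grp ≤ S.proj (S.der 1) i := by
  obtain ⟨x, y, hx, hy, hxy⟩ := S.nonconst
  have h1 : ∀ j k, S.comp j i * (S.comp k i)⁻¹ ∈ S.proj (S.der 1) i := fun j k =>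
    mem_proj.2 ⟨S.comp j * (S.comp k)⁻¹, by
      rw [map_mul, map_inv, ← β_eq, ← β_eq]; exact S.β_mul_inv_mem j k, rfl⟩
  have ne : ∀ {z : ZMod p}, z ≠ 0 → i ≠ i - z := fun hz h => hz (by
    simpa using h.symm)
  have ha : S.a ∈ S.proj (S.der 1) i := by
    have := h1 (i - x) (i - y)
    rw [comp_ne (ne hx), comp_ne (ne hy), sub_sub_cancel, sub_sub_cancel,
      ← zmodPow_sub S.a_pow] at this
    exact mem_of_zmodPow_mem S.a_pow (sub_ne_zero.2 hxy) this
  rw [grp, Subgroup.closure_le]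
  rintro s (rfl | rfl)
  · exact ha
  · have := h1 i (i - x)
    rw [comp_self, comp_ne (ne hx)] at this
    simpa using (S.proj (S.der 1) i).mul_mem this (zmodPow_mem ha (S.ε (i - (i - x))))

theorem der_one_le_proj_der_two (i : ZMod p) : S.der 1 ≤ S.proj (S.der 2) i := by
  refine Subgroup.commutator_le.2 fun g hg h hh => ?_
  obtain ⟨f, hf, rfl⟩ := mem_proj.1 (S.grp_le_proj_der_one i hg)
  obtain ⟨k, hk, rfl⟩ := mem_proj.1 (S.grp_le_proj_der_one i hh)
  refine mem_proj.2 ⟨⁅f, k⁆, ?_, rfl⟩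
  rw [map_commutatorElement]
  exact Subgroup.commutator_mem_commutator hf hk

variable {S} in
-- Conjugation by h inside one factor is realised by an element of G' having component h there.
theorem level_normalizedBy {M : Subgroup Γ} (hM : NormalizedBy M S.grp) :
    NormalizedBy (S.level M) S.grp := by
  intro h hh g hg
  rw [mem_level]
  intro i
  obtain ⟨f, hf, rfl⟩ := mem_proj.1 (S.grp_le_proj_der_one i hh)
  rw [← conj_single]
  exact hM _ (S.der_le_grp 1 hf) _ (mem_level.1 hg i)

/-- For g in the level of Stab', the copy of g in a factor lies in Stab' ≤ G'. Commuting it with an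
element of G' with prescribed component there lands in G''. -/
theorem commutator_level_le : ⁅S.level ⁅S.stab, S.stab⁆, S.grp⁆ ≤ S.level (S.der 2) := by
  refine Subgroup.commutator_le.2 fun g hg h hh => ?_
  rw [mem_level]
  intro i
  obtain ⟨f, hf, rfl⟩ := mem_proj.1 (S.grp_le_proj_der_one i hh)
  rw [← commutator_single]
  exact Subgroup.commutator_mem_commutator (S.commutator_stab_le (mem_level.1 hg i)) hf

end GGSData

/-- The elements of `G` that are central modulo a subgroup `T` normalized by `G`. -/
def NormalizedBy.centralMod {Γ : Type*} [Group Γ] {T G : Subgroup Γ} (hT : NormalizedBy T G) :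
    Subgroup Γ where
  carrier := {g | g ∈ G ∧ ∀ h ∈ G, ⁅g, h⁆ ∈ T}
  one_mem' := ⟨G.one_mem, fun h _ => by simp⟩
  mul_mem' := by
    rintro x y ⟨hx, hx'⟩ ⟨hy, hy'⟩
    refine ⟨G.mul_mem hx hy, fun h hh => ?_⟩
    have : ⁅x * y, h⁆ = x * ⁅y, h⁆ * x⁻¹ * ⁅x, h⁆ := by
      simp only [commutatorElement_def]; group
    rw [this]
    exact T.mul_mem (hT x hx _ (hy' h hh)) (hx' h hh)
  inv_mem' := by
    rintro x ⟨hx, hx'⟩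
    refine ⟨G.inv_mem hx, fun h hh => ?_⟩
    have : ⁅x⁻¹, h⁆ = x⁻¹ * ⁅x, h⁆⁻¹ * x := by
      simp only [commutatorElement_def]; group
    rw [this]
    exact hT.conj' hx (T.inv_mem (hx' h hh))

namespace NormalizedBy

variable {Γ : Type*} [Group Γ] {T G : Subgroup Γ}

theorem centralMod_normalizedBy (hT : NormalizedBy T G) : NormalizedBy hT.centralMod G := by
  rintro k hk g ⟨hg, hg'⟩
  refine ⟨NormalizedBy.refl G k hk g hg, fun h hh => ?_⟩
  have : ⁅k * g * k⁻¹, h⁆ = k * ⁅g, k⁻¹ * h * k⁆ * k⁻¹ := by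
    simp only [commutatorElement_def]; group
  rw [this]
  exact hT k hk _ (hg' _ ((NormalizedBy.refl G).conj' hk hh))

theorem mem_centralMod_of_closure (hT : NormalizedBy T G) {A : Set Γ} (hA : G = Subgroup.closure A)
    {g : Γ} (hg : g ∈ G) (h : ∀ s ∈ A, ⁅g, s⁆ ∈ T) : g ∈ hT.centralMod := by
  refine ⟨hg, fun k hk => ?_⟩
  have h1 : Subgroup.closure {g} ≤ G := by simpa using hg
  have h2 : ⁅Subgroup.closure {g}, Subgroup.closure A⁆ ≤ T :=
    closure_commutator_le (hT.mono h1) (hA ▸ hT) fun s hs t ht => by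
      rw [Set.mem_singleton_iff.1 hs]; exact h t ht
  exact h2 (Subgroup.commutator_mem_commutator (Subgroup.subset_closure rfl) (hA ▸ hk))

theorem commutator_closure_pair_le {x y : Γ} (hT : NormalizedBy T (Subgroup.closure {x, y}))
    (h : ⁅x, y⁆ ∈ T) : ⁅Subgroup.closure {x, y}, Subgroup.closure {x, y}⁆ ≤ T := by
  refine hT.closure_commutator_le hT ?_
  have h' : ⁅y, x⁆ ∈ T := by rw [← commutatorElement_inv]; exact T.inv_mem h
  rintro s (rfl | rfl) t (rfl | rfl)
  · simp
  · exact h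
  · exact h'
  · simp

theorem commutator_pow_mem {Γ : Type} [Group Γ] {T G : Subgroup Γ} (hT : NormalizedBy T G)
    {y z : Γ} (hy : y ∈ G) (hz : z ∈ G) (h : ⁅⁅y, z⁆, z⁆ ∈ T) (n : ℕ) :
    ⁅y, z⁆ ^ n * ⁅y, z ^ n⁆⁻¹ ∈ T := by
  obtain ⟨Q, _, π, -, hπ⟩ := hT.exists_quotient
  let y' : G := ⟨y, hy⟩
  let z' : G := ⟨z, hz⟩
  have h1 : π ⁅⁅y', z'⁆, z'⁆ = 1 := (hπ _).2 h
  refine (hπ (⁅y', z'⁆ ^ n * ⁅y', z' ^ n⁆⁻¹)).1 ?_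
  rw [map_commutatorElement, map_commutatorElement, commutatorElement_eq_one_iff_commute] at h1
  rw [map_mul, map_inv, map_commutatorElement, map_pow, map_pow, map_commutatorElement,
    commutatorElement_pow_right_of_commute h1, mul_inv_cancel]

end NormalizedBy

/-! ### Lower central series and commutators of conjugates of b -/

namespace GGSData

variable {p : ℕ} [Fact p.Prime] {Γ : Type} [Group Γ] (S : GGSData p Γ)

/-- The third term of the lower central series. -/
def γ₃ : Subgroup Γ := ⁅S.der 1, S.grp⁆

/-- The fourth term of the lower central series. -/
def γ₄ : Subgroup Γ := ⁅S.γ₃, S.grp⁆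

theorem γ₃_normalizedBy : NormalizedBy S.γ₃ S.grp :=
  (S.der_normalizedBy 1).commutator (NormalizedBy.refl _)

theorem γ₄_normalizedBy : NormalizedBy S.γ₄ S.grp :=
  S.γ₃_normalizedBy.commutator (NormalizedBy.refl _)

theorem γ₃_le_der_one : S.γ₃ ≤ S.der 1 := (S.der_normalizedBy 1).commutator_le

variable {S}

theorem der_one_le {N : Subgroup Γ} (hN : NormalizedBy N S.grp) {x y : Γ}
    (hxy : S.grp = Subgroup.closure {x, y}) (h : ⁅x, y⁆ ∈ N) : S.der 1 ≤ N := by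
  rw [der_succ, der, hxy]
  rw [hxy] at hN
  exact hN.commutator_closure_pair_le h

theorem grp_eq_closure {x y : Γ} (hx : x ∈ S.grp) (hy : y ∈ S.grp)
    (ha : S.a ∈ Subgroup.closure {x, y}) (hb : S.b ∈ Subgroup.closure {x, y}) :
    S.grp = Subgroup.closure {x, y} := by
  apply le_antisymm
  · rw [grp, Subgroup.closure_le]
    rintro s (rfl | rfl)
    · exact ha
    · exact hb
  · rw [Subgroup.closure_le]
    rintro s (rfl | rfl)
    · exact hx
    · exact hy

/-- G is generated by b and a ^ c, so once their commutator is central modulo T, all of G' is. -/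
theorem γ₃_le {T : Subgroup Γ} (hT : NormalizedBy T S.grp) {c : ZMod p} (hc : c ≠ 0)
    (ha : ⁅⁅S.b, zmodPow S.a c⁆, S.a⁆ ∈ T) (hb : ⁅⁅S.b, zmodPow S.a c⁆, S.b⁆ ∈ T) :
    S.γ₃ ≤ T := by
  have hac := zmodPow_mem S.a_mem c
  have hgen : S.grp = Subgroup.closure {S.b, zmodPow S.a c} :=
    grp_eq_closure S.b_mem hac
      (mem_of_zmodPow_mem S.a_pow hc (Subgroup.subset_closure (by simp)))
      (Subgroup.subset_closure (by simp))
  have h1 : ⁅S.b, zmodPow S.a c⁆ ∈ hT.centralMod := by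
    refine hT.mem_centralMod_of_closure rfl
      ((NormalizedBy.refl S.grp).commutator_mem S.b_mem hac) ?_
    rintro s (rfl | rfl)
    · exact ha
    · exact hb
  have h2 := der_one_le hT.centralMod_normalizedBy hgen h1
  exact Subgroup.commutator_le.2 fun g hg h hh => (h2 hg).2 h hh

variable (S)

theorem single_zpow_mul_single_zpow (i j : ZMod p) (q : Γ) (u v n : ℤ) :
    (S.single i (q ^ u) * S.single j (q ^ v)) ^ n =
      S.single i (q ^ (u * n)) * S.single j (q ^ (v * n)) := by
  have h : Commute (S.single i (q ^ u)) (S.single j (q ^ v)) := by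
    by_cases hij : i = j
    · subst hij
      exact ((Commute.refl q).zpow_zpow u v).map (S.single i)
    · exact (Pi.mulSingle_commute hij _ _).map S.psi
  rw [h.mul_zpow, ← map_zpow, ← map_zpow, ← zpow_mul, ← zpow_mul]

variable {S}

theorem single_mul_single_mem_congr {M : Subgroup Γ} {i j : ZMod p} {g g' h h' : Γ}
    (hg : g' * g⁻¹ ∈ S.level M) (hh : h⁻¹ * h' ∈ S.level M)
    (H : S.single i g * S.single j h ∈ M) : S.single i g' * S.single j h' ∈ M := by
  have := M.mul_mem (M.mul_mem (mem_level.1 hg i) H) (mem_level.1 hh j)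
  simp only [map_mul, map_inv] at this
  simpa [mul_assoc] using this

/-- If `M` contains `q ^ x` in one direct factor times `q ^ (-y)` in another one, then it contains
`q ^ (x ^ p - y ^ p)` in a single factor. -/
theorem mem_level_of_single_zpow_mem {M : Subgroup Γ} (hM : NormalizedBy M S.grp) {q : Γ}
    (hq : q ^ p ∈ S.level M) {i j : ZMod p} {x y : ℤ} (hxy : (x : ZMod p) ≠ y)
    (H : S.single i (q ^ x) * S.single j (q ^ (-y)) ∈ M) : q ∈ S.level M := by
  -- Multiplying suitable powers of translates of `H` cancels the intermediate factors; after p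
  -- steps the position returns to i. There x ^ p - y ^ p ≡ x - y is invertible mod p, and q ^ p is
  -- already available.
  have key : ∀ s : ℕ, S.single i (q ^ (x ^ s)) *
      S.single (i + s * (j - i)) (q ^ (-(y ^ s))) ∈ M := by
    intro s
    induction s with
    | zero => simp
    | succ s ih =>
      have h1 := M.zpow_mem ih x
      have h2 := M.zpow_mem (single_mem_shift hM H (s * (j - i))) (y ^ s)
      rw [single_zpow_mul_single_zpow] at h1 h2
      have h3 := M.mul_mem h1 h2
      have e1 : j + s * (j - i) = i + ((s + 1 : ℕ) : ZMod p) * (j - i) := by push_cast; ring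
      have e2 : x * y ^ s = -(-y ^ s * x) := by ring
      have e3 : -y * y ^ s = -(y ^ (s + 1)) := by ring
      rw [e1, e2, e3, zpow_neg, map_inv, mul_assoc, mul_inv_cancel_left, ← pow_succ] at h3
      exact h3
  have h1 := key p
  rw [CharP.cast_eq_zero, zero_mul, add_zero, ← map_mul, ← zpow_add] at h1
  have h2 := mem_level_of_single_mem hM h1
  have h3 : IsCoprime (x ^ p + -y ^ p) (p : ℤ) := by
    rw [isCoprime_comm, Prime.coprime_iff_not_dvd (Nat.prime_iff_prime_int.1 Fact.out),
      ← ZMod.intCast_zmod_eq_zero_iff_dvd]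
    push_cast
    rw [ZMod.pow_card, ZMod.pow_card, ← sub_eq_add_neg]
    exact sub_ne_zero.2 hxy
  obtain ⟨u, v, huv⟩ := h3
  have h4 := (S.level M).mul_mem ((S.level M).zpow_mem h2 u) ((S.level M).zpow_mem hq v)
  rwa [← zpow_natCast, ← zpow_mul, ← zpow_mul, ← zpow_add, mul_comm _ u, mul_comm _ v, huv,
    zpow_one] at h4

theorem commutator_single_mul_single {i j : ZMod p} (hij : i ≠ j) (g h : Γ) (f : ZMod p → Γ) :
    ⁅S.single i g * S.single j h, S.psi f⁆ = S.single i ⁅g, f i⁆ * S.single j ⁅h, f j⁆ := by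
  rw [single_apply, single_apply, ← map_mul, ← map_commutatorElement,
    psi_eq_single_mul_single S hij]
  · simp [commutatorElement_def, hij, hij.symm]
  · intro x hi hj
    simp [commutatorElement_def, hi, hj]

theorem commute_zmodPow (x y : ZMod p) : ⁅zmodPow S.a x, zmodPow S.a y⁆ = 1 :=
  commutatorElement_eq_one_iff_commute.2 ((Commute.refl S.a).pow_pow _ _)

/-- At every position other than i and j both components are powers of a and commute. -/
theorem commutator_β {i j : ZMod p} (hij : i ≠ j) : ⁅S.β i, S.β j⁆ =
    S.single i ⁅S.b, zmodPow S.a (S.ε (i - j))⁆ * S.single j ⁅zmodPow S.a (S.ε (j - i)), S.b⁆ := by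
  rw [β_eq, β_eq, ← map_commutatorElement, psi_eq_single_mul_single S hij]
  · rw [← comp_ne hij, ← comp_ne hij.symm, ← S.comp_self i]
    congr 3
    rw [comp_self, ← S.comp_self j]
    rfl
  · intro x hi hj
    change ⁅S.comp i x, S.comp j x⁆ = 1
    rw [comp_ne hi, comp_ne hj, commute_zmodPow]

theorem commutator_β_mem {i j : ZMod p} : ⁅S.β i, S.β j⁆ ∈ ⁅S.stab, S.stab⁆ :=
  Subgroup.commutator_mem_commutator (S.β_mem_stab i) (S.β_mem_stab j)

/-- Commuting [β i, β j] with ψ f, where f j = 1, leaves only [[b, a ^ c], f i] at position i, with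
c = ε (i - j). The determinant condition lets products of powers of β k and β l take arbitrary
powers of a at i and j, so f i can be made a or b, as `γ₃_le` requires. -/
theorem γ₃_le_level {i j k l : ZMod p} (hij : i ≠ j) (hki : i ≠ k) (hkj : j ≠ k) (hli : i ≠ l)
    (hlj : j ≠ l) (hε : S.ε (i - j) ≠ 0)
    (hdet : S.ε (i - k) * S.ε (j - l) - S.ε (i - l) * S.ε (j - k) ≠ 0) :
    S.γ₃ ≤ S.level ⁅S.stab, S.stab⁆ := by
  have hM := S.commutator_stab_normalizedBy
  have key : ∀ f, S.psi f ∈ S.stab → f j = 1 →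
      ⁅⁅S.b, zmodPow S.a (S.ε (i - j))⁆, f i⁆ ∈ S.level ⁅S.stab, S.stab⁆ := by
    intro f hf hfj
    have h1 : ⁅⁅S.β i, S.β j⁆, S.psi f⁆ ∈ ⁅S.stab, S.stab⁆ :=
      (hM.mono S.stab_le_grp).commutator_mem commutator_β_mem hf
    rw [commutator_β hij, commutator_single_mul_single hij, hfj, commutatorElement_one_right,
      map_one, mul_one] at h1
    exact mem_level_of_single_mem hM h1
  have solve : ∀ r s : ZMod p, ∃ f, S.psi f ∈ S.stab ∧ f i = zmodPow S.a r ∧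
      f j = zmodPow S.a s := by
    intro r s
    -- Cramer's rule for the exponents of β k and β l.
    let d := S.ε (i - k) * S.ε (j - l) - S.ε (i - l) * S.ε (j - k)
    let α := (r * S.ε (j - l) - s * S.ε (i - l)) / d
    let α' := (s * S.ε (i - k) - r * S.ε (j - k)) / d
    refine ⟨fun x => zmodPow (S.comp k x) α * zmodPow (S.comp l x) α', ?_, ?_, ?_⟩
    · have : S.psi (fun x => zmodPow (S.comp k x) α * zmodPow (S.comp l x) α') =
          zmodPow (S.β k) α * zmodPow (S.β l) α' := by
        rw [β_eq, β_eq, zmodPow_psi, zmodPow_psi, ← map_mul]; rfl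
      rw [this]
      exact S.stab.mul_mem (zmodPow_mem (S.β_mem_stab k) _) (zmodPow_mem (S.β_mem_stab l) _)
    · change zmodPow (S.comp k i) α * zmodPow (S.comp l i) α' = _
      rw [comp_ne hki, comp_ne hli, zmodPow_zmodPow S.a_pow, zmodPow_zmodPow S.a_pow,
        ← zmodPow_add S.a_pow]
      congr 1
      simp only [α, α', d]
      rw [mul_div_assoc', mul_div_assoc', ← add_div, div_eq_iff hdet]
      ring
    · change zmodPow (S.comp k j) α * zmodPow (S.comp l j) α' = _
      rw [comp_ne hkj, comp_ne hlj, zmodPow_zmodPow S.a_pow, zmodPow_zmodPow S.a_pow,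
        ← zmodPow_add S.a_pow]
      congr 1
      simp only [α, α', d]
      rw [mul_div_assoc', mul_div_assoc', ← add_div, div_eq_iff hdet]
      ring
  refine γ₃_le (level_normalizedBy hM) hε ?_ ?_
  · obtain ⟨f, hf, hfi, hfj⟩ := solve 1 0
    rw [zmodPow_zero] at hfj
    have := key f hf hfj
    rwa [hfi, zmodPow_one] at this
  · obtain ⟨f, hf, hfi, hfj⟩ := solve 0 (-S.ε (j - i))
    -- Here β i contributes b at i, and `f` cancels its component at j.
    have := key (S.comp i * f) (by
      rw [map_mul, ← β_eq]; exact S.stab.mul_mem (S.β_mem_stab i) hf) (by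
      rw [Pi.mul_apply, comp_ne hij.symm, hfj, zmodPow_neg S.a_pow, mul_inv_cancel])
    rwa [Pi.mul_apply, comp_self, hfi, zmodPow_zero, mul_one] at this

end GGSData

/-! ### Case distinction on the defining tuple -/

namespace GGSData

variable {p : ℕ} [Fact p.Prime] {Γ : Type} [Group Γ] {S : GGSData p Γ}

theorem two_ne_zero_zmod (S : GGSData p Γ) : (2 : ZMod p) ≠ 0 := by
  intro h
  have h1 : ((2 : ℕ) : ZMod p) = 0 := by exact_mod_cast h
  rw [ZMod.natCast_eq_zero_iff, Nat.prime_dvd_prime_iff_eq Fact.out Nat.prime_two] at h1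
  have := S.odd
  rw [h1] at this
  exact absurd this (by decide)

theorem ε_eq_of_recurrence {δ μ : ZMod p} (hδ : δ ≠ 0)
    (hrec : ∀ n, n ≠ 0 → n ≠ δ → S.ε n = μ * S.ε (n - δ)) (s : ℕ) (hs : s + 1 < p) :
    S.ε ((s + 1 : ℕ) * δ) = S.ε δ * μ ^ s := by
  induction s with
  | zero => simp
  | succ s ih =>
    have hne : ∀ m : ℕ, 0 < m → m < p → ((m : ℕ) : ZMod p) ≠ 0 := fun m h0 h1 h => by
      rw [ZMod.natCast_eq_zero_iff] at h
      exact absurd (Nat.le_of_dvd h0 h) (by omega)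
    have e : ((s + 1 + 1 : ℕ) : ZMod p) * δ - δ = (s + 1 : ℕ) * δ := by push_cast; ring
    rw [hrec, e, ih (by omega)]
    · ring
    · exact mul_ne_zero (hne _ (by omega) hs) hδ
    · intro h
      rw [← sub_eq_zero, e] at h
      exact mul_ne_zero (hne _ (by omega) (by omega)) hδ h

/-- With μ = 1 the values at δ, 2δ, ..., (p-1)δ, hence at all non-zero arguments, would coincide. -/
theorem recurrence_ne_one {δ μ : ZMod p} (hδ : δ ≠ 0)
    (hrec : ∀ n, n ≠ 0 → n ≠ δ → S.ε n = μ * S.ε (n - δ)) : μ ≠ 1 := by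
  rintro rfl
  have h : ∀ x, x ≠ 0 → S.ε x = S.ε δ := by
    intro x hx
    have h0 : (x / δ).val ≠ 0 := by
      rw [Ne, ZMod.val_eq_zero]; exact div_ne_zero hx hδ
    obtain ⟨s, hs⟩ := Nat.exists_eq_succ_of_ne_zero h0
    have h1 := ZMod.val_lt (x / δ)
    have h2 := ε_eq_of_recurrence hδ hrec s (by omega)
    rwa [← Nat.succ_eq_add_one, ← hs, ZMod.natCast_zmod_val, div_mul_cancel₀ _ hδ, one_pow,
      mul_one] at h2
  obtain ⟨x, y, hx, hy, hxy⟩ := S.nonconst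
  exact hxy ((h x hx).trans (h y hy).symm)

/-- By the recurrence, β c · β (c + δ) ^ (-μ) has non-trivial components at most at c and c + δ. The
elements for c = 0 and c = δ overlap only at δ, so their commutator is confined to that position,
and their components there generate G. -/
theorem der_one_le_level_of_recurrence {δ μ : ZMod p} (hδ : δ ≠ 0) (hε : S.ε δ ≠ 0)
    (hrec : ∀ n, n ≠ 0 → n ≠ δ → S.ε n = μ * S.ε (n - δ)) :
    S.der 1 ≤ S.level ⁅S.stab, S.stab⁆ := by
  have hp : p.Prime := Fact.out
  have hM := S.commutator_stab_normalizedBy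
  have hμ := recurrence_ne_one hδ hrec
  have hδ2 : δ ≠ δ + δ := by simpa using hδ
  have h02 : (0 : ZMod p) ≠ δ + δ := by
    rw [← two_mul]; exact (mul_ne_zero S.two_ne_zero_zmod hδ).symm
  -- Following the recurrence from δ to (p-1)δ = -δ gives ε (-δ) = ε δ · μ ^ (p-2); then Fermat's
  -- little theorem applies.
  have hν : μ = 0 ∨ μ * S.ε (-δ) = S.ε δ := by
    by_cases h0 : μ = 0
    · exact Or.inl h0
    · right
      have h2 := hp.two_le
      have h1 := ε_eq_of_recurrence hδ hrec (p - 2) (by omega)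
      have e : ((p - 2 + 1 : ℕ) : ZMod p) * δ = -δ := by
        rw [show p - 2 + 1 = p - 1 by omega, Nat.cast_sub (by omega)]
        simp
      rw [e] at h1
      rw [h1, mul_left_comm, ← pow_succ', show p - 2 + 1 = p - 1 by omega,
        ZMod.pow_card_sub_one_eq_one h0, mul_one]
  let U : ZMod p → ZMod p → Γ := fun c x => S.comp c x * zmodPow (S.comp (c + δ) x) (-μ)
  have hU : ∀ c, S.psi (U c) ∈ S.stab := by
    intro c
    have : S.psi (U c) = S.β c * zmodPow (S.β (c + δ)) (-μ) := by
      rw [β_eq, β_eq, zmodPow_psi, ← map_mul]; rfl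
    rw [this]
    exact S.stab.mul_mem (S.β_mem_stab c) (zmodPow_mem (S.β_mem_stab _) _)
  have hU1 : ∀ c x, x ≠ c → x ≠ c + δ → U c x = 1 := by
    intro c x h1 h2
    simp only [U]
    rw [comp_ne h1, comp_ne h2, zmodPow_zmodPow S.a_pow, ← zmodPow_add S.a_pow,
      hrec (x - c) (sub_ne_zero.2 h1) (fun h => h2 (by rw [← h]; ring)), ← sub_sub,
      show μ * S.ε (x - c - δ) + S.ε (x - c - δ) * -μ = 0 by ring, zmodPow_zero]
  have hX : U 0 δ = zmodPow S.a (S.ε δ) * zmodPow S.b (-μ) := by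
    simp only [U]
    rw [zero_add, comp_self, comp_ne hδ, sub_zero]
  have hY : U δ δ = S.b * zmodPow S.a (-(μ * S.ε (-δ))) := by
    simp only [U]
    rw [comp_self, comp_ne hδ2, zmodPow_zmodPow S.a_pow, sub_add_cancel_left, mul_neg, mul_comm]
  have h1 : ⁅U 0 δ, U δ δ⁆ ∈ S.level ⁅S.stab, S.stab⁆ := by
    refine mem_level_of_single_mem (i := δ) hM ?_
    have := Subgroup.commutator_mem_commutator (hU 0) (hU δ)
    rw [← map_commutatorElement, psi_eq_single S (i := δ)] at this
    · exact this
    · intro x hx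
      change ⁅U 0 x, U δ x⁆ = 1
      by_cases h0 : x = 0
      · subst h0
        rw [hU1 δ 0 hδ.symm h02, commutatorElement_one_right]
      · rw [hU1 0 x h0 (by rwa [zero_add]), commutatorElement_one_left]
  rw [hX, hY] at h1
  refine der_one_le (level_normalizedBy hM) (grp_eq_closure ?_ ?_ ?_ ?_) h1
  · exact S.grp.mul_mem (zmodPow_mem S.a_mem _) (zmodPow_mem S.b_mem _)
  · exact S.grp.mul_mem S.b_mem (zmodPow_mem S.a_mem _)
  all_goals
    set X := zmodPow S.a (S.ε δ) * zmodPow S.b (-μ)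
    set Y := S.b * zmodPow S.a (-(μ * S.ε (-δ)))
    have hXm : X ∈ Subgroup.closure {X, Y} := Subgroup.subset_closure (by simp)
    have hYm : Y ∈ Subgroup.closure {X, Y} := Subgroup.subset_closure (by simp)
    have hb : S.b ∈ Subgroup.closure {X, Y} := by
      rcases hν with h0 | h0
      · have : Y = S.b := by simp [Y, h0, zmodPow_zero]
        rwa [this] at hYm ⊢
      -- The powers of a cancel in the middle, and 1 - μ is non-zero.
      · have : Y * X = zmodPow S.b (1 - μ) := by
          simp only [X, Y]
          rw [h0, mul_assoc, ← mul_assoc (zmodPow S.a _), ← zmodPow_add S.a_pow, neg_add_cancel,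
            zmodPow_zero, one_mul, sub_eq_add_neg, zmodPow_add S.b_pow, zmodPow_one]
        exact mem_of_zmodPow_mem S.b_pow (sub_ne_zero.2 hμ.symm)
          (this ▸ Subgroup.mul_mem _ hYm hXm)
  · have : X * zmodPow S.b μ = zmodPow S.a (S.ε δ) := by
      simp only [X]
      rw [zmodPow_neg S.b_pow, inv_mul_cancel_right]
    exact mem_of_zmodPow_mem S.a_pow hε (this ▸ Subgroup.mul_mem _ hXm (zmodPow_mem hb μ))
  · exact hb

/-- Modulo γ₃, [b, a ^ n] is [b, a] ^ n. Thus [β t, β 0] amounts to powers of [b, a] with exponents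
ε t and -ε (-t) at two positions, and `mem_level_of_single_zpow_mem` isolates [b, a]. -/
theorem der_one_le_level_of_not_symmetric (h3 : S.γ₃ ≤ S.level ⁅S.stab, S.stab⁆) {t : ZMod p}
    (ht : S.ε t ≠ S.ε (-t)) : S.der 1 ≤ S.level ⁅S.stab, S.stab⁆ := by
  have hM := S.commutator_stab_normalizedBy
  have ht0 : t ≠ 0 := by rintro rfl; simp at ht
  have hq : ∀ n : ℕ, ⁅S.b, S.a⁆ ^ n * ⁅S.b, S.a ^ n⁆⁻¹ ∈ S.level ⁅S.stab, S.stab⁆ := fun n =>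
    h3 (S.γ₃_normalizedBy.commutator_pow_mem S.b_mem S.a_mem
      (Subgroup.commutator_mem_commutator
        (Subgroup.commutator_mem_commutator S.b_mem S.a_mem) S.a_mem) n)
  have h1 : ⁅S.b, S.a⁆ ∈ S.level ⁅S.stab, S.stab⁆ := by
    refine mem_level_of_single_zpow_mem (i := t) (j := 0) (x := (S.ε t).val)
      (y := (S.ε (-t)).val) hM ?_ ?_ ?_
    · simpa [S.a_pow] using hq p
    · simpa using ht
    · have h2 : ⁅S.β t, S.β 0⁆ ∈ ⁅S.stab, S.stab⁆ := commutator_β_mem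
      rw [commutator_β ht0, sub_zero, zero_sub] at h2
      refine single_mul_single_mem_congr ?_ ?_ h2
      · rw [zpow_natCast]
        exact hq _
      · rw [commutatorElement_inv, zpow_neg, zpow_natCast]
        simpa [zmodPow] using (S.level _).inv_mem (hq (S.ε (-t)).val)
  refine der_one_le (level_normalizedBy hM) (x := S.b) (y := S.a) ?_ h1
  rw [grp, Set.pair_comm]

/-- For symmetric ε the exponents just used coincide, so the argument is repeated one commutator
deeper: w = [β δ, β 0] has components q and q⁻¹, and commuting it with elements of G' gives elements
of G''. Since γ₄ is already in the level of G'', [q, a ^ n] is [q, a] ^ n modulo that level. -/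
theorem γ₃_le_level_der_two_of_symmetric (h3 : S.γ₃ ≤ S.level ⁅S.stab, S.stab⁆) {δ : ZMod p}
    (hδ : δ ≠ 0) (hε : S.ε δ ≠ 0) (hs : ∀ t, S.ε (-t) = S.ε t) :
    S.γ₃ ≤ S.level (S.der 2) := by
  have hM := S.der_normalizedBy 2
  have hT := level_normalizedBy hM
  have h4 : S.γ₄ ≤ S.level (S.der 2) :=
    (Subgroup.commutator_mono h3 le_rfl).trans S.commutator_level_le
  obtain ⟨k, hk0, hkδ, hk⟩ : ∃ k, k ≠ 0 ∧ k ≠ δ ∧ S.ε k ≠ S.ε (k - δ) := by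
    by_contra! h
    exact recurrence_ne_one (μ := 1) hδ (fun n h0 h1 => by rw [one_mul, h n h0 h1]) rfl
  have hkδ' : S.ε (k - δ) = S.ε (δ - k) := by rw [← hs, neg_sub]
  obtain ⟨q, hqd⟩ : ∃ q, q = ⁅S.b, zmodPow S.a (S.ε δ)⁆ := ⟨_, rfl⟩
  obtain ⟨r, hrd⟩ : ∃ r, r = ⁅q, S.a⁆ := ⟨_, rfl⟩
  have hq1 : q ∈ S.der 1 := hqd ▸ Subgroup.commutator_mem_commutator S.b_mem (zmodPow_mem S.a_mem _)
  have hq : q ∈ S.grp := S.der_le_grp 1 hq1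
  have hr : r ∈ S.γ₃ := hrd ▸ Subgroup.commutator_mem_commutator hq1 S.a_mem
  have hrn : ∀ n : ℕ, r ^ n * ⁅q, S.a ^ n⁆⁻¹ ∈ S.level (S.der 2) := fun n => by
    rw [hrd]
    exact h4 (S.γ₄_normalizedBy.commutator_pow_mem hq S.a_mem
      (hrd ▸ Subgroup.commutator_mem_commutator hr S.a_mem) n)
  have hw : S.single δ q * S.single 0 q⁻¹ ∈ S.der 1 := by
    have := S.commutator_stab_le (commutator_β_mem (i := δ) (j := 0))
    rw [commutator_β hδ, sub_zero, zero_sub, hs, ← commutatorElement_inv S.b, ← hqd] at this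
    exact this
  have key : ∀ f, S.psi f ∈ S.der 1 →
      S.single δ ⁅q, f δ⁆ * S.single 0 ⁅q⁻¹, f 0⁆ ∈ S.der 2 := by
    intro f hf
    rw [← commutator_single_mul_single hδ]
    exact Subgroup.commutator_mem_commutator hw hf
  have hβ : ∀ i j, S.psi (S.comp i * (S.comp j)⁻¹) ∈ S.der 1 := fun i j => by
    rw [map_mul, map_inv, ← β_eq, ← β_eq]; exact S.β_mul_inv_mem i j
  have hrT : r ∈ S.level (S.der 2) := by
    -- The element β k · β (δ - k)⁻¹ has components a ^ d at δ and a ^ (-d) at 0, by symmetry.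
    -- Inverting both q and the exponent gives r ^ d at both positions modulo the level, so x = d
    -- and y = -d differ because p is odd.
    refine mem_level_of_single_zpow_mem (i := δ) (j := 0) (x := (S.ε (δ - k) - S.ε k).val)
      (y := (S.ε k - S.ε (δ - k)).val) hM ?_ ?_ ?_
    · simpa [S.a_pow] using hrn p
    · rw [Int.cast_natCast, Int.cast_natCast, ZMod.natCast_zmod_val, ZMod.natCast_zmod_val]
      intro h
      have h2 : 2 * (S.ε (δ - k) - S.ε k) = 0 := by linear_combination h
      rcases mul_eq_zero.1 h2 with h2 | h2
      · exact S.two_ne_zero_zmod h2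
      · exact hk (by rw [hkδ', sub_eq_zero.1 h2])
    · have h1 := key _ (hβ k (δ - k))
      have e1 : (S.comp k * (S.comp (δ - k))⁻¹) δ = zmodPow S.a (S.ε (δ - k) - S.ε k) := by
        rw [Pi.mul_apply, Pi.inv_apply, comp_ne hkδ.symm,
          comp_ne (fun h => hk0 (by simpa using h.symm)), zmodPow_sub S.a_pow, sub_sub_cancel]
      have e2 : (S.comp k * (S.comp (δ - k))⁻¹) 0 = zmodPow S.a (S.ε k - S.ε (δ - k)) := by
        rw [Pi.mul_apply, Pi.inv_apply, comp_ne hk0.symm,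
          comp_ne (sub_ne_zero.2 hkδ.symm).symm, zmodPow_sub S.a_pow, zero_sub, zero_sub, hs, hs]
      rw [e1, e2] at h1
      refine single_mul_single_mem_congr ?_ ?_ h1
      · rw [zpow_natCast]
        exact hrn _
      · rw [zpow_neg, zpow_natCast]
        set n := (S.ε k - S.ε (δ - k)).val
        have e3 : ⁅q⁻¹, zmodPow S.a (S.ε k - S.ε (δ - k))⁆⁻¹ * (r ^ n)⁻¹ =
            q⁻¹ * ((r ^ n * ⁅q, S.a ^ n⁆⁻¹)⁻¹ * ⁅r ^ n, q⁆) * q := by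
          simp only [commutatorElement_def, zmodPow, n]
          group
        rw [e3]
        exact hT.conj' hq (Subgroup.mul_mem _ (Subgroup.inv_mem _ (hrn n))
          (h4 (Subgroup.commutator_mem_commutator (S.γ₃.pow_mem hr n) hq)))
  have hpow : ∀ d : ZMod p, ⁅q, zmodPow S.a d⁆ ∈ S.level (S.der 2) := by
    intro d
    have h1 : Subgroup.closure {q} ≤ S.grp := by simpa using hq
    have h2 : Subgroup.closure {S.a} ≤ S.grp := by simpa using S.a_mem
    have h3 := (hT.mono h1).closure_commutator_le (hT.mono h2) (by
      rintro s rfl t rfl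
      exact hrd ▸ hrT)
    have h4 : q ∈ Subgroup.closure {q} := Subgroup.mem_closure_singleton_self q
    have h5 : S.a ∈ Subgroup.closure {S.a} := Subgroup.mem_closure_singleton_self S.a
    exact h3 (Subgroup.commutator_mem_commutator h4 (zmodPow_mem h5 d))
  have hpow' : ∀ d : ZMod p, ⁅q⁻¹, zmodPow S.a d⁆ ∈ S.level (S.der 2) := by
    intro d
    have e : ⁅q⁻¹, zmodPow S.a d⁆ = q⁻¹ * ⁅q, zmodPow S.a d⁆⁻¹ * q := by
      simp only [commutatorElement_def]
      group
    rw [e]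
    exact hT.conj' hq (Subgroup.inv_mem _ (hpow d))
  refine γ₃_le hT hε (by rwa [← hqd, ← hrd]) ?_
  rw [← hqd]
  -- This element of G' has b times a power of a at δ but only a power of a at 0, where the
  -- commutator is negligible by `hpow'`.
  have h1 := key _ (hβ δ k)
  have e1 : (S.comp δ * (S.comp k)⁻¹) δ = S.b * zmodPow S.a (-S.ε (δ - k)) := by
    rw [Pi.mul_apply, Pi.inv_apply, comp_self, comp_ne hkδ.symm, zmodPow_neg S.a_pow]
  have e2 : (S.comp δ * (S.comp k)⁻¹) 0 = zmodPow S.a (S.ε (0 - δ) - S.ε (0 - k)) := by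
    rw [Pi.mul_apply, Pi.inv_apply, comp_ne hδ.symm, comp_ne hk0.symm, zmodPow_sub S.a_pow]
  rw [e1, e2] at h1
  have h2 := mem_level_of_single_mem hM
    (((S.der 2).mul_mem_cancel_right (mem_level.1 (hpow' _) 0)).1 h1)
  have e3 : ⁅q, S.b * zmodPow S.a (-S.ε (δ - k))⁆ =
      ⁅q, S.b⁆ * (S.b * ⁅q, zmodPow S.a (-S.ε (δ - k))⁆ * S.b⁻¹) := by
    simp only [commutatorElement_def]
    group
  rw [e3] at h2
  exact (Subgroup.mul_mem_cancel_right _ (hT _ S.b_mem _ (hpow _))).1 h2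

variable (S)

theorem exists_ε_ne_zero : ∃ δ, δ ≠ 0 ∧ S.ε δ ≠ 0 := by
  obtain ⟨x, y, hx, hy, hxy⟩ := S.nonconst
  by_cases h : S.ε x = 0
  · exact ⟨y, hy, fun h' => hxy (h.trans h'.symm)⟩
  · exact ⟨x, hx, h⟩

/-- The direct power of the third term of the lower central series is contained in the second
derived subgroup. -/
theorem γ₃_le_level_der_two : S.γ₃ ≤ S.level (S.der 2) := by
  obtain ⟨δ, hδ, hε⟩ := S.exists_ε_ne_zero
  have of_der_one : S.der 1 ≤ S.level ⁅S.stab, S.stab⁆ → S.γ₃ ≤ S.level (S.der 2) := fun h =>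
    (Subgroup.commutator_mono h le_rfl).trans S.commutator_level_le
  -- The pairs (ε m, ε (m - δ)) are either all proportional, and m = 2δ then gives the ratio μ of
  -- the recurrence, or two of them have non-zero determinant.
  by_cases h : ∀ m n, m ≠ 0 → m ≠ δ → n ≠ 0 → n ≠ δ →
      S.ε m * S.ε (n - δ) = S.ε n * S.ε (m - δ)
  · refine of_der_one (der_one_le_level_of_recurrence (μ := S.ε (2 * δ) / S.ε δ) hδ hε ?_)
    intro n h0 h1
    have h2 := h (2 * δ) n (mul_ne_zero S.two_ne_zero_zmod hδ) (by
      rw [two_mul]; simpa using hδ) h0 h1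
    rw [two_mul, add_sub_cancel_right, ← two_mul] at h2
    rw [div_mul_eq_mul_div, h2, mul_div_cancel_right₀ _ hε]
  · push Not at h
    obtain ⟨m, n, hm0, hmδ, hn0, hnδ, hmn⟩ := h
    have h3 : S.γ₃ ≤ S.level ⁅S.stab, S.stab⁆ := by
      refine γ₃_le_level (i := δ) (j := 0) (k := δ - m) (l := δ - n) hδ ?_ ?_ ?_ ?_ ?_ ?_
      · exact fun h => hm0 (by simpa using h.symm)
      · exact (sub_ne_zero.2 hmδ.symm).symm
      · exact fun h => hn0 (by simpa using h.symm)
      · exact (sub_ne_zero.2 hnδ.symm).symm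
      · simpa using hε
      · simpa [sub_eq_zero] using hmn
    by_cases hs : ∀ t, S.ε (-t) = S.ε t
    · exact γ₃_le_level_der_two_of_symmetric h3 hδ hε hs
    · push Not at hs
      obtain ⟨t, ht⟩ := hs
      exact of_der_one (der_one_le_level_of_not_symmetric h3 ht.symm)

/-! ### Exponents of the factors of the derived series -/

/-- G' is generated by [a, b] and γ₃, and [a, b] commutes with itself. -/
theorem der_two_le : S.der 2 ≤ ⁅S.γ₃, S.der 1⁆ := by
  let d := ⁅S.a, S.b⁆
  have hd : d ∈ S.der 1 := Subgroup.commutator_mem_commutator S.a_mem S.b_mem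
  let A : Set Γ := insert d S.γ₃
  have hA : ∀ x ∈ S.γ₃, x ∈ Subgroup.closure A := fun x hx =>
    Subgroup.subset_closure (Or.inr hx)
  have hdA : d ∈ Subgroup.closure A := Subgroup.subset_closure (Or.inl rfl)
  have hN : NormalizedBy (Subgroup.closure A) S.grp := by
    intro g hg n hn
    have : Subgroup.closure A ≤ (Subgroup.closure A).comap (MulAut.conj g).toMonoidHom := by
      rw [Subgroup.closure_le]
      rintro x (rfl | hx)
      · have e : g * d * g⁻¹ = ⁅g, d⁆ * d := by simp [commutatorElement_def]
        have h1 : ⁅g, d⁆ ∈ S.γ₃ := by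
          rw [← commutatorElement_inv]
          exact S.γ₃.inv_mem (Subgroup.commutator_mem_commutator hd hg)
        simpa [e] using Subgroup.mul_mem _ (hA _ h1) hdA
      · simpa using hA _ (S.γ₃_normalizedBy g hg x hx)
    simpa using this hn
  have h1 : S.der 1 ≤ Subgroup.closure A := der_one_le hN rfl hdA
  have h2 : Subgroup.closure A ≤ S.der 1 := by
    rw [Subgroup.closure_le]
    rintro x (rfl | hx)
    · exact hd
    · exact S.γ₃_le_der_one hx
  have hK : NormalizedBy ⁅S.γ₃, S.der 1⁆ (Subgroup.closure A) :=
    (S.γ₃_normalizedBy.commutator (S.der_normalizedBy 1)).mono (h2.trans (S.der_le_grp 1))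
  refine (Subgroup.commutator_mono h1 h1).trans (hK.closure_commutator_le hK ?_)
  rintro s (rfl | hs) t (rfl | ht)
  · simp
  · rw [Subgroup.commutator_comm]
    exact Subgroup.commutator_mem_commutator hd ht
  · exact Subgroup.commutator_mem_commutator hs hd
  · exact Subgroup.commutator_mem_commutator hs (S.γ₃_le_der_one ht)

/-- For the base case, G'' ≤ [γ₃, G']: a copy of γ₃ in one factor lies in G'', and G'' projects onto
a group containing G', so the commutators lie in G'''. Later cases follow by taking commutators. -/
theorem der_le_level (n : ℕ) : S.der (n + 2) ≤ S.level (S.der (n + 3)) := by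
  induction n with
  | zero =>
    refine S.der_two_le.trans (Subgroup.commutator_le.2 fun g hg h hh => ?_)
    rw [mem_level]
    intro i
    obtain ⟨f, hf, rfl⟩ := mem_proj.1 (S.der_one_le_proj_der_two i hh)
    rw [← commutator_single]
    exact Subgroup.commutator_mem_commutator (mem_level.1 (S.γ₃_le_level_der_two hg) i) hf
  | succ n ih =>
    refine Subgroup.commutator_le.2 fun g hg h hh => mem_level.2 fun i => ?_
    rw [map_commutatorElement]
    exact Subgroup.commutator_mem_commutator (mem_level.1 (ih hg) i) (mem_level.1 (ih hh) i)

theorem exists_psi_eq_of_mem_der (n : ℕ) : ∀ g ∈ S.der (n + 1),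
    ∃ f, S.psi f = g ∧ ∀ x, f x ∈ S.der n := by
  induction n with
  | zero =>
    let N : Subgroup Γ := (Subgroup.pi Set.univ fun _ => S.grp).map S.psi
    have hf : ∀ f, (∀ x, f x ∈ S.grp) → S.psi f ∈ N := fun f hf => ⟨f, fun x _ => hf x, rfl⟩
    have hb : S.b ∈ N := by
      rw [S.b_eq]
      refine hf _ fun x => ?_
      split_ifs
      · exact S.b_mem
      · exact zmodPow_mem S.a_mem _
    have hconj : ∀ c : ZMod p, ∀ n ∈ N, zmodPow S.a c * n * (zmodPow S.a c)⁻¹ ∈ N := by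
      rintro c _ ⟨f, hf', rfl⟩
      rw [conj_zmodPow]
      exact hf _ fun x => hf' _ (Set.mem_univ _)
    have hN : NormalizedBy N S.grp := by
      refine NormalizedBy.of_closure ?_ ?_
      · rintro s (rfl | rfl) n hn
        · simpa [zmodPow_one] using hconj 1 n hn
        · exact NormalizedBy.refl _ _ hb _ hn
      · rintro s (rfl | rfl) n hn
        · simpa [zmodPow_neg S.a_pow, zmodPow_one] using hconj (-1) n hn
        · exact (NormalizedBy.refl _).conj' hb hn
    intro g hg
    obtain ⟨f, hf', hfg⟩ := der_one_le hN rfl (hN.commutator_mem' hb S.a_mem) hg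
    exact ⟨f, hfg, fun x => hf' x (Set.mem_univ _)⟩
  | succ n ih =>
    let N : Subgroup Γ := (Subgroup.pi Set.univ fun _ => S.der (n + 1)).map S.psi
    suffices h : S.der (n + 2) ≤ N by
      intro g hg
      obtain ⟨f, hf', hfg⟩ := h hg
      exact ⟨f, hfg, fun x => hf' x (Set.mem_univ _)⟩
    refine Subgroup.commutator_le.2 fun g hg h hh => ?_
    obtain ⟨f, rfl, hf⟩ := ih g hg
    obtain ⟨k, rfl, hk⟩ := ih h hh
    exact ⟨⁅f, k⁆, fun x _ => Subgroup.commutator_mem_commutator (hf x) (hk x),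
      map_commutatorElement _ _ _⟩

/-- In the class-2 quotient the Hall formula applies, and its correction term vanishes because the
odd prime p divides p(p-1)/2. -/
theorem pow_mem_γ₃ {g : Γ} (hg : g ∈ S.grp) : g ^ p ∈ S.γ₃ := by
  obtain ⟨Q, _, π, hsurj, hπ⟩ := S.γ₃_normalizedBy.exists_quotient
  have hc : ∀ x y z : Q, Commute ⁅x, y⁆ z := by
    intro x y z
    obtain ⟨x, rfl⟩ := hsurj x
    obtain ⟨y, rfl⟩ := hsurj y
    obtain ⟨z, rfl⟩ := hsurj z
    rw [← commutatorElement_eq_one_iff_commute, ← map_commutatorElement,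
      ← map_commutatorElement, hπ]
    exact Subgroup.commutator_mem_commutator (Subgroup.commutator_mem_commutator x.2 y.2) z.2
  have hp2 : p ∣ p.choose 2 := by
    have hp : p.Prime := Fact.out
    have h2 := hp.two_le
    have h3 : p ≠ 2 := by
      intro h
      have := S.odd
      rw [h] at this
      exact absurd this (by decide)
    exact hp.dvd_choose_self (by norm_num) (by omega)
  have key : ∀ h : g ∈ S.grp, π ⟨g, h⟩ ^ p = 1 := by
    clear hg
    intro h
    induction h using Subgroup.closure_induction with
    | mem x hx =>
      rw [← map_pow]
      have : (⟨x, Subgroup.subset_closure hx⟩ : S.grp) ^ p = 1 := by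
        apply Subtype.ext
        rcases hx with rfl | rfl
        · exact S.a_pow
        · exact S.b_pow
      rw [this, map_one]
    | one => exact (congrArg (· ^ p) (map_one π)).trans (one_pow p)
    | mul x y hx hy ihx ihy =>
      have e : π ⟨x * y, Subgroup.mul_mem _ hx hy⟩ = π ⟨x, hx⟩ * π ⟨y, hy⟩ :=
        map_mul π ⟨x, hx⟩ ⟨y, hy⟩
      obtain ⟨m, hm⟩ := hp2
      rw [e, mul_pow_of_commute_commutator (hc _ _ _) (hc _ _ _), hm, pow_mul,
        ← commutatorElement_pow_right_of_commute (hc _ _ _), ihx, ihy]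
      simp
    | inv x hx ih =>
      have e : π ⟨x⁻¹, Subgroup.inv_mem _ hx⟩ = (π ⟨x, hx⟩)⁻¹ := map_inv π ⟨x, hx⟩
      rw [e, inv_pow, ih, inv_one]
  have := key hg
  rw [← map_pow, hπ] at this
  exact this

/-- All factors of the derived series have exponent dividing `p`. -/
theorem pow_mem_der_succ (n : ℕ) : ∀ g ∈ S.der n, g ^ p ∈ S.der (n + 1) := by
  induction n with
  | zero => exact fun g hg => S.γ₃_le_der_one (S.pow_mem_γ₃ hg)
  | succ n ih =>
    intro g hg
    obtain ⟨f, rfl, hf⟩ := S.exists_psi_eq_of_mem_der n g hg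
    rw [← map_pow]
    refine S.psi_mem_of_forall_mem_level fun x => ?_
    rw [Pi.pow_apply]
    rcases n with _ | n
    · exact S.γ₃_le_level_der_two (S.pow_mem_γ₃ (hf x))
    · exact S.der_le_level n (ih _ (hf x))

end GGSData

/-! ### GGS-groups -/

/-- The permutation of the words that acts by `f x` on the words starting with `x`, after
removal of this letter. -/
def consPerm {X : Type} : (X → Equiv.Perm (List X)) →* Equiv.Perm (List X) where
  toFun f :=
    { toFun := fun w => match w with
        | [] => []
        | x :: v => x :: f x v
      invFun := fun w => match w with
        | [] => []
        | x :: v => x :: (f x).symm v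
      left_inv := by rintro (_ | ⟨x, v⟩) <;> simp
      right_inv := by rintro (_ | ⟨x, v⟩) <;> simp }
  map_one' := by ext1 (_ | ⟨x, v⟩) <;> rfl
  map_mul' f g := by ext1 (_ | ⟨x, v⟩) <;> rfl

theorem consPerm_cons {X : Type} (f : X → Equiv.Perm (List X)) (x : X) (v : List X) :
    consPerm f (x :: v) = x :: f x v := rfl

/-- A tree automorphism as a permutation of the vertices. -/
def TreeAut.toPerm {X : Type} : TreeAut X →* Equiv.Perm (List X) where
  toFun g := g.toEquiv
  map_one' := rfl
  map_mul' _ _ := rfl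

theorem TreeAut.toPerm_injective {X : Type} : Function.Injective (TreeAut.toPerm (X := X)) :=
  fun _ _ h => RelIso.toEquiv_injective h

section

variable {p : ℕ}

theorem rootedGen_pow_cons (n : ℕ) (x : ZMod p) (v : List (ZMod p)) :
    (rootedGen p ^ n) (x :: v) = (x + n) :: v := by
  induction n generalizing x with
  | zero => simp
  | succ n ih =>
    have : rootedGen p (x :: v) = (x + 1) :: v := rfl
    rw [pow_succ, RelIso.mul_apply, this, ih]
    push_cast
    ring_nf

theorem rootedGen_pow_self (p : ℕ) : rootedGen p ^ p = 1 := by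
  ext1 w
  rcases w with _ | ⟨x, v⟩
  · exact rootedGen_pow_nil p p
  · rw [rootedGen_pow_cons]
    simp

variable [Fact p.Prime] (e : {x : ZMod p // x ≠ 0} → ZMod p)

/-- The defining tuple, extended by `0`. -/
def extendTuple (x : ZMod p) : ZMod p := if h : x = 0 then 0 else e ⟨x, h⟩

theorem toPerm_directedGen : TreeAut.toPerm (directedGen e) = consPerm fun x =>
    if x = 0 then TreeAut.toPerm (directedGen e)
    else zmodPow (TreeAut.toPerm (rootedGen p)) (extendTuple e x) := by
  ext1 w
  rcases w with _ | ⟨x, v⟩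
  · rfl
  · rw [consPerm_cons]
    have hdef : ∀ w, TreeAut.toPerm (directedGen e) w =
        directedFun (fun x => rootedGen p ^ (e x).val) w := fun _ => rfl
    rw [hdef]
    by_cases h : x = 0
    · simp only [directedFun, h, dite_true, if_true]
      rfl
    · simp only [directedFun, h, dite_false, if_false, extendTuple, zmodPow]
      rw [← map_pow]
      rfl

/-- The p-th power of b has sections b ^ p at 0 and 1 elsewhere, so it is trivial by induction on
the word. -/
theorem toPerm_directedGen_pow : TreeAut.toPerm (directedGen e) ^ p = 1 := by
  have ha : TreeAut.toPerm (rootedGen p) ^ p = 1 := by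
    rw [← map_pow, rootedGen_pow_self, map_one]
  have hb : TreeAut.toPerm (directedGen e) ^ p = consPerm fun x =>
      if x = 0 then TreeAut.toPerm (directedGen e) ^ p else 1 := by
    conv_lhs => rw [toPerm_directedGen, ← map_pow]
    congr 1
    funext x
    by_cases h : x = 0
    · simp [h]
    · simp [h, zmodPow_pow_prime ha]
  ext1 w
  induction w with
  | nil => rw [hb]; rfl
  | cons x v ih =>
    rw [hb, consPerm_cons]
    by_cases h : x = 0
    · rw [if_pos h, ih]; rfl
    · rw [if_neg h]; rfl

/-- The generators of a GGS-group satisfy the defining relations. -/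
def ggsData (hp : Odd p) (he : ∃ i j, e i ≠ e j) : GGSData p (Equiv.Perm (List (ZMod p))) where
  psi := consPerm
  a := TreeAut.toPerm (rootedGen p)
  b := TreeAut.toPerm (directedGen e)
  ε := extendTuple e
  odd := hp
  a_pow := by rw [← map_pow, rootedGen_pow_self, map_one]
  b_pow := toPerm_directedGen_pow e
  conj f := by
    rw [mul_inv_eq_iff_eq_mul]
    ext1 w
    rcases w with _ | ⟨x, v⟩
    · rfl
    · change (x + 1) :: f x v = (x + 1) :: f (x + 1 - 1) v
      rw [add_sub_cancel_right]
  b_eq := toPerm_directedGen e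
  nonconst := by
    obtain ⟨⟨x, hx⟩, ⟨y, hy⟩, h⟩ := he
    exact ⟨x, y, hx, hy, by simpa [extendTuple, hx, hy] using h⟩

/-- Transfers the exponent statement to the abstract group: the embedding into all permutations of
words, where `consPerm` needs no compatibility with adjacency, is injective. -/
theorem map_toPerm_derivedSeries (hp : Odd p) (he : ∃ i j, e i ≠ e j) (n : ℕ) :
    (derivedSeries (GGSGroup e) n).map (TreeAut.toPerm.comp (GGSGroup e).subtype) =
      (ggsData e hp he).der n := by
  induction n with
  | zero =>
    rw [derivedSeries_zero, ← Subgroup.map_map, ← MonoidHom.range_eq_map, Subgroup.range_subtype,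
      GGSGroup, MonoidHom.map_closure, Set.image_pair]
    rfl
  | succ n ih => rw [derivedSeries_succ, Subgroup.map_commutator, ih, GGSData.der_succ]

theorem pow_mem_derivedSeries_succ (hp : Odd p) (he : ∃ i j, e i ≠ e j) (n : ℕ)
    (g : GGSGroup e) (hg : g ∈ derivedSeries (GGSGroup e) n) :
    g ^ p ∈ derivedSeries (GGSGroup e) (n + 1) := by
  have hinj : Function.Injective (TreeAut.toPerm.comp (GGSGroup e).subtype) :=
    TreeAut.toPerm_injective.comp Subtype.val_injective
  have h1 := Subgroup.mem_map_of_mem (TreeAut.toPerm.comp (GGSGroup e).subtype) hg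
  rw [map_toPerm_derivedSeries e hp he] at h1
  have h2 := (ggsData e hp he).pow_mem_der_succ n _ h1
  rw [← map_toPerm_derivedSeries, ← map_pow] at h2
  exact (Subgroup.mem_map_iff_mem hinj).1 h2

/-- On the children of any vertex, the elements of a GGS-group act by translations. -/
theorem exists_apply_append_singleton {g : TreeAut (ZMod p)} (hg : g ∈ GGSGroup e)
    (u : List (ZMod p)) : ∃ t, ∀ x, g (u ++ [x]) = g u ++ [x + t] := by
  have ha : ∀ (n : ℕ) (u : List (ZMod p)),
      ∃ t, ∀ x, (rootedGen p ^ n) (u ++ [x]) = (rootedGen p ^ n) u ++ [x + t] := by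
    rintro n (_ | ⟨y, v⟩)
    · exact ⟨n, fun x => by rw [List.nil_append, rootedGen_pow_cons, rootedGen_pow_nil]; rfl⟩
    · exact ⟨0, fun x => by
        rw [List.cons_append, rootedGen_pow_cons, rootedGen_pow_cons, add_zero, List.cons_append]⟩
  induction hg using Subgroup.closure_induction generalizing u with
  | mem g hg =>
    rcases hg with rfl | rfl
    · simpa using ha 1 u
    · change ∃ t, ∀ x, directedFun _ (u ++ [x]) = directedFun _ u ++ [x + t]
      induction u with
      | nil =>
        refine ⟨0, fun x => ?_⟩
        by_cases h : x = 0
        · simp [directedFun, h]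
        · simp [directedFun, h, rootedGen_pow_nil]
      | cons y v ih =>
        by_cases h : y = 0
        · obtain ⟨t, ht⟩ := ih
          exact ⟨t, fun x => by simp [directedFun, h, ht]⟩
        · obtain ⟨t, ht⟩ := ha (e ⟨y, h⟩).val v
          exact ⟨t, fun x => by simp [directedFun, h, ht]⟩
  | one => exact ⟨0, fun x => by simp⟩
  | mul g k _ _ ihg ihk =>
    obtain ⟨s, hs⟩ := ihk u
    obtain ⟨t, ht⟩ := ihg (k u)
    exact ⟨s + t, fun x => by rw [RelIso.mul_apply, hs, ht, RelIso.mul_apply, add_assoc]⟩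
  | inv g _ ih =>
    obtain ⟨t, ht⟩ := ih (g⁻¹ u)
    refine ⟨-t, fun x => g.injective ?_⟩
    rw [ht, RelIso.apply_inv_self, RelIso.apply_inv_self, neg_add_cancel_right]

theorem exists_eq_addRight_of_mem_localGroup {σ : Equiv.Perm (ZMod p)}
    (hσ : σ ∈ localGroup (GGSGroup e)) : ∃ t, σ = Equiv.addRight t := by
  induction hσ using Subgroup.closure_induction with
  | mem σ h =>
    obtain ⟨g, hg, u, h, hsec, hroot⟩ := h
    obtain ⟨t, ht⟩ := exists_apply_append_singleton e hg u
    refine ⟨t, Equiv.ext fun x => ?_⟩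
    have h1 := hsec [x]
    rw [hroot, ht] at h1
    simpa using h1.symm
  | one => exact ⟨0, by ext; simp⟩
  | mul σ τ _ _ ihσ ihτ =>
    obtain ⟨s, rfl⟩ := ihσ
    obtain ⟨t, rfl⟩ := ihτ
    exact ⟨t + s, by ext1 x; simp [add_assoc]⟩
  | inv σ _ ih =>
    obtain ⟨t, rfl⟩ := ih
    exact ⟨-t, by ext1 x; simp [Equiv.Perm.inv_def]⟩

theorem addRight_one_mem_localGroup : Equiv.addRight (1 : ZMod p) ∈ localGroup (GGSGroup e) :=
  Subgroup.subset_closure ⟨rootedGen p, Subgroup.subset_closure (by simp), [], rootedGen p,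
    fun _ => rfl, fun _ => rfl⟩

theorem orderOf_addRight_one :
    orderOf (⟨Equiv.addRight (1 : ZMod p), addRight_one_mem_localGroup e⟩ :
      localGroup (GGSGroup e)) = p := by
  apply orderOf_eq_prime
  · apply Subtype.ext
    change Equiv.addRight (1 : ZMod p) ^ p = 1
    have h : ∀ n : ℕ, Equiv.addRight (1 : ZMod p) ^ n = Equiv.addRight (n : ZMod p) := by
      intro n
      induction n with
      | zero => ext1 x; simp
      | succ n ih => rw [pow_succ, ih]; ext1 x; simp; ring
    rw [h]
    ext1 x
    simp
  · intro h
    have h1 := Equiv.congr_fun (congrArg Subtype.val h) (0 : ZMod p)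
    simp at h1

end
theorem mainTheorem4 (p : ℕ) [Fact p.Prime] (hp : Odd p)
    (e : {x : ZMod p // x ≠ 0} → ZMod p) (he : ∃ i j, e i ≠ e j) (n : ℕ) :
    iteratedLocalLaws (GGSGroup e) n = derivedSeries (GGSGroup e) n := by
  refine verbalSubgroup_iteratedLaws (p := p) ?_ (orderOf_addRight_one e) n _
    fun m g hg => pow_mem_derivedSeries_succ e hp he m g hg
  rintro ⟨σ, hσ⟩ ⟨τ, hτ⟩
  obtain ⟨s, rfl⟩ := exists_eq_addRight_of_mem_localGroup e hσ
  obtain ⟨t, rfl⟩ := exists_eq_addRight_of_mem_localGroup e hτ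
  apply Subtype.ext
  ext1 x
  simp [add_right_comm]
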